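/- Notation. For $0<q<1$ let $(x;q)_n=\prod_{i=0}^{n-1}(1-xq^i)$, $(x;q)_\infty=\prod_{i\ge 0}(1-xq^i)$, $(x_1,\dots,x_m;q)_n=\prod_j (x_j;q)_n$, and, for complex $x$, $$\Gamma_q(x)=(1-q)^{1-x}\frac{(q;q)_\infty}{(q^x;q)_\infty}.$$ Write $(x)_n=x(x+1)\cdots(x+n-1)$. (1) For every $0<q<1$ all series below converge and $$\frac{(1-q^2)^4}{(1-q)^2\,\Gamma_{q^2}(1/2)^6}\sum_{k\ge 0}(-1)^k q^{3k(k+1)}\,\frac{1+q^{1+2k}}{1+q}\,\frac{1-q}{1-q^{1+2k}}=\sum_{n\ge 0}T_n(q),$$ where $$T_n(q)=\frac{q^{2n}\,p_n(q)\,(q^2;q^2)_{3n}\,(q;q^2)_n^6}{(q^{2n}+q^{4n}+1)(q^{2n+1}+1)^3(q^2;q^2)_n^3(q^2;q^2)_{2n}^3},$$ $$p_n(q)=3q^{2n+1}-4q^{4n+1}+2q^{4n+2}-4q^{6n+1}-4q^{6n+2}+2q^{8n+1}-4q^{8n+2}+3q^{10n+2}+3q^{12n+3}+3 .$$ (2)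 This is a $q$-analogue of Guillera's formula $$\sum_{n\ge 0}\Big(\frac{3^3}{4^3}\Big)^n\frac{(\frac12)_n^3(\frac13)_n(\frac23)_n}{(1)_n^5}(74n^2+27n+3)=\frac{48}{\pi^2}$$ in the following sense: as $q\to 1^-$, for each $n$, $$\frac{T_n(q)}{(1-q)^2}\to \frac1{12}\Big(\frac{3^3}{4^3}\Big)^n\frac{(\frac12)_n^3(\frac13)_n(\frac23)_n}{(1)_n^5}(74n^2+27n+3),$$ and the left-hand side of (1) divided by $(1-q)^2$ tends to $\frac1{12}\cdot\frac{48}{\pi^2}$. (3) Let $$\mathsf{Dougall5F4}_q(a,b,c,d,k)=\frac{q^{k(a-b-c-d+1)}(1-q^{a+2k})\Gamma_q(a+k)\Gamma_q(b+k)\Gamma_q(c+k)\Gamma_q(d+k)\Gamma_q(a-b-c+1)\Gamma_q(a-b-d+1)\Gamma_q(a-c-d+1)}{(1-q)\Gamma_q(b)\Gamma_q(c)\Gamma_q(d)\Gamma_q(k+1)\Gamma_q(a-b+k+1)\Gamma_q(a-c+k+1)\Gamma_q(a-d+k+1)\Gamma_q(a-b-c-d+1)}$$ and $F(n,k)=\mathsf{Dougall5F4}_q(\tfrac12-n,\tfrac12-n,\tfrac12-n,n,2n+k)$.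 Let $0<q<1$ and let $a\in\mathbb C$ be such that neither $q^{2a}$ nor $q^{3a}$ is an integer power of $q$ (in particular this holds for all $a\neq 0$ close enough to $0$). Then $\sum_{k\ge0}F(n+a,k)$ converges for every integer $n\ge 0$, and the limit $L(a)=\lim_{n\to\infty}\sum_{k\ge 0}F(n+a,k)$ exists, is nonzero, and equals $$L(a)=\frac{q^a\,\Gamma_q(1-a)^2\,\Gamma_q(a)^2}{\Gamma_q(\frac32)^2\,\Gamma_q(\frac12-a)^2\,\Gamma_q(a+\frac12)^2}\sum_{k\ge 0}(-1)^kq^{3k(k+1)/2}\,\frac{1+q^{1/2+k}}{1+q^{1/2}}\,\frac{1-q^{1/2}}{1-q^{1/2+k}} .$$ (4) Under the same assumptions on $q$ and $a$, put $$A=\frac{q^a(1-q^a)\,\Gamma_q(1-a)^2\,\Gamma_q(a+\frac12)^4\,\Gamma_q(3a+1)}{\Gamma_q(\frac12)^2\,\Gamma_q(\frac12-a)^2\,\Gamma_q(a+1)\,\Gamma_q(2a+1)^3}.$$ Then $A\neq 0$, the series below converge, and $$\sum_{k\ge 0}\frac{q^{k/2}(1-q^{3a+2k+\frac12})(q^{3a+1};q)_k(q^{a+\frac12};q)_k^3}{(1-q^{k+\frac12})(1-q^{3a+k})(q^{1/2};q)_k(q^{2a+1};q)_k^3}=\sum_{n\ge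 0}\frac{q^{a+n}P_q(n)(q^{3a+1};q)_{3n}(q^{a+\frac12};q)_n^6}{(1-q^a)^3(q^{a+n}+q^{2a+2n}+1)(1-q^{2a+2n+1})^3(q^{a+1};q)_n^3(q^{2a+1};q)_{2n}^3}+\frac{L(a)}{A},$$ where, with $x=q^{a+n}$, $$\begin{aligned}P_q(n)={}&6xq^{1/2}-2x^2q+4x^2q^{1/2}-8x^3q+4x^3q^{1/2}-8x^4q-3x^4q^2-2x^4q^{1/2}+3x^5q+8x^5q^2+2x^5q^{5/2}\\&+8x^6q^2-4x^6q^{5/2}+2x^7q^2-4x^7q^{5/2}-6x^8q^{5/2}+3x^9q^3-3.\end{aligned}$$ -/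

import Mathlib

open Filter Topology

noncomputable section

/-- The finite `q`-shifted factorial `(a; q)_n = ∏_{i < n} (1 - a q^i)`. -/
def qPoch (a q : ℂ) (n : ℕ) : ℂ := ∏ i ∈ Finset.range n, (1 - a * q ^ i)

/-- The infinite `q`-shifted factorial `(a; q)_∞ = ∏_{i ≥ 0} (1 - a q^i)`, for `|q| < 1`. -/
def qPochInf (a q : ℂ) : ℂ := ∏' i : ℕ, (1 - a * q ^ i)

/-- The `q`-gamma function
`Γ_q(x) = (1 - q)^(1 - x) (q; q)_∞ / (q^x; q)_∞`, for `0 < q < 1` and complex `x`. -/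
def qGamma (q : ℝ) (x : ℂ) : ℂ :=
  (1 - (q : ℂ)) ^ (1 - x) * qPochInf q q / qPochInf ((q : ℂ) ^ x) q

/-- The classical rising factorial `(x)_n = x (x + 1) ⋯ (x + n - 1)`. -/
def rising (x : ℂ) (n : ℕ) : ℂ := ∏ i ∈ Finset.range n, (x + i)

/-- The summand of Guillera's series
`∑ (27/64)^n (1/2)_n^3 (1/3)_n (2/3)_n / (1)_n^5 * (74 n^2 + 27 n + 3)`. -/
def guilleraTerm (n : ℕ) : ℂ :=
  ((3 : ℂ) ^ 3 / 4 ^ 3) ^ n * (rising (1 / 2) n ^ 3 * rising (1 / 3) n * rising (2 / 3) n) /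
    rising 1 n ^ 5 * (74 * (n : ℂ) ^ 2 + 27 * n + 3)

/-- The summand of the explicit `q`-series. -/
def qGuilleraTerm (q : ℂ) (n : ℕ) : ℂ :=
  q ^ (2 * n) *
      (3 * q ^ (2 * n + 1) - 4 * q ^ (4 * n + 1) + 2 * q ^ (4 * n + 2) - 4 * q ^ (6 * n + 1)
        - 4 * q ^ (6 * n + 2) + 2 * q ^ (8 * n + 1) - 4 * q ^ (8 * n + 2)
        + 3 * q ^ (10 * n + 2) + 3 * q ^ (12 * n + 3) + 3) *
      qPoch (q ^ 2) (q ^ 2) (3 * n) * qPoch q (q ^ 2) n ^ 6 /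
    ((q ^ (2 * n) + q ^ (4 * n) + 1) * (q ^ (2 * n + 1) + 1) ^ 3 *
      qPoch (q ^ 2) (q ^ 2) n ^ 3 * qPoch (q ^ 2) (q ^ 2) (2 * n) ^ 3)

/-- `(-1)^k p^(3k(k+1)) (1 + p^(1+2k)) / (1 + p) * (1 - p) / (1 - p^(1+2k))`. -/
def altTerm (p : ℂ) (k : ℕ) : ℂ :=
  (-1) ^ k * p ^ (3 * k * (k + 1)) * ((1 + p ^ (1 + 2 * k)) / (1 + p)) *
    ((1 - p) / (1 - p ^ (1 + 2 * k)))

/-- The `q`-gamma factor times the alternating series: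
`(1 - q^2)^4 / ((1 - q)^2 Γ_{q^2}(1/2)^6) * ∑_k altTerm q k`. -/
def qGuilleraValue (q : ℝ) : ℂ :=
  (1 - (q : ℂ) ^ 2) ^ 4 / ((1 - (q : ℂ)) ^ 2 * qGamma (q ^ 2) (1 / 2) ^ 6) *
    ∑' k : ℕ, altTerm q k

/-- The term `Dougall5F4_q(a, b, c, d, k)`; here `k` is a complex variable. -/
def dougall5F4q (q : ℝ) (a b c d k : ℂ) : ℂ :=
  (q : ℂ) ^ (k * (a - b - c - d + 1)) * (1 - (q : ℂ) ^ (a + 2 * k)) *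
      qGamma q (a + k) * qGamma q (b + k) * qGamma q (c + k) * qGamma q (d + k) *
      qGamma q (a - b - c + 1) * qGamma q (a - b - d + 1) * qGamma q (a - c - d + 1) /
    ((1 - (q : ℂ)) * qGamma q b * qGamma q c * qGamma q d * qGamma q (k + 1) *
      qGamma q (a - b + k + 1) * qGamma q (a - c + k + 1) * qGamma q (a - d + k + 1) *
      qGamma q (a - b - c - d + 1))

/-- `F(n, k) = Dougall5F4_q(1/2 - n, 1/2 - n, 1/2 - n, n, 2n + k)`, with `n` a complex variable. -/
def wzF (q : ℝ) (n : ℂ) (k : ℕ) : ℂ :=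
  dougall5F4q q (1 / 2 - n) (1 / 2 - n) (1 / 2 - n) n (2 * n + k)

/-- The value of the boundary limit. The series is
`∑_k (-1)^k q^(3k(k+1)/2) (1 + q^(1/2+k)) / (1 + q^(1/2)) * (1 - q^(1/2)) / (1 - q^(1/2+k))`,
which is the series of `altTerm p k` at `p = q^(1/2)`. -/
def boundaryValue (q : ℝ) (a : ℂ) : ℂ :=
  (q : ℂ) ^ a * qGamma q (1 - a) ^ 2 * qGamma q a ^ 2 /
      (qGamma q (3 / 2) ^ 2 * qGamma q (1 / 2 - a) ^ 2 * qGamma q (a + 1 / 2) ^ 2) *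
    ∑' k : ℕ, altTerm ((q : ℂ) ^ (1 / 2 : ℂ)) k

/-- The factor `A`. -/
def factorA (q : ℝ) (a : ℂ) : ℂ :=
  (q : ℂ) ^ a * (1 - (q : ℂ) ^ a) * qGamma q (1 - a) ^ 2 * qGamma q (a + 1 / 2) ^ 4 *
      qGamma q (3 * a + 1) /
    (qGamma q (1 / 2) ^ 2 * qGamma q (1 / 2 - a) ^ 2 * qGamma q (a + 1) *
      qGamma q (2 * a + 1) ^ 3)

/-- The summand of the `k`-series in the identity with the parameter `a`. -/
def kTerm (q : ℝ) (a : ℂ) (k : ℕ) : ℂ :=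
  (q : ℂ) ^ ((k : ℂ) / 2) * (1 - (q : ℂ) ^ (3 * a + 2 * k + 1 / 2)) *
      qPoch ((q : ℂ) ^ (3 * a + 1)) q k * qPoch ((q : ℂ) ^ (a + 1 / 2)) q k ^ 3 /
    ((1 - (q : ℂ) ^ ((k : ℂ) + 1 / 2)) * (1 - (q : ℂ) ^ (3 * a + k)) *
      qPoch ((q : ℂ) ^ (1 / 2 : ℂ)) q k * qPoch ((q : ℂ) ^ (2 * a + 1)) q k ^ 3)

/-- The polynomial `P_q(n)` of the identity with the parameter `a`,
written in `x = q^(a+n)` and `s = q^(1/2)`. -/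
def polyP (q s x : ℂ) : ℂ :=
  6 * x * s - 2 * x ^ 2 * q + 4 * x ^ 2 * s - 8 * x ^ 3 * q + 4 * x ^ 3 * s
    - 8 * x ^ 4 * q - 3 * x ^ 4 * q ^ 2 - 2 * x ^ 4 * s + 3 * x ^ 5 * q + 8 * x ^ 5 * q ^ 2
    + 2 * x ^ 5 * (q ^ 2 * s) + 8 * x ^ 6 * q ^ 2 - 4 * x ^ 6 * (q ^ 2 * s) + 2 * x ^ 7 * q ^ 2
    - 4 * x ^ 7 * (q ^ 2 * s) - 6 * x ^ 8 * (q ^ 2 * s) + 3 * x ^ 9 * q ^ 3 - 3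

/-- The summand of the `n`-series in the identity with the parameter `a`. -/
def nTerm (q : ℝ) (a : ℂ) (n : ℕ) : ℂ :=
  (q : ℂ) ^ (a + n) * polyP q ((q : ℂ) ^ (1 / 2 : ℂ)) ((q : ℂ) ^ (a + n)) *
      qPoch ((q : ℂ) ^ (3 * a + 1)) q (3 * n) * qPoch ((q : ℂ) ^ (a + 1 / 2)) q n ^ 6 /
    ((1 - (q : ℂ) ^ a) ^ 3 * ((q : ℂ) ^ (a + n) + (q : ℂ) ^ (2 * a + 2 * n) + 1) *
      (1 - (q : ℂ) ^ (2 * a + 2 * n + 1)) ^ 3 * qPoch ((q : ℂ) ^ (a + 1)) q n ^ 3 *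
      qPoch ((q : ℂ) ^ (2 * a + 1)) q (2 * n) ^ 3)

end

/-!
Write `q = s ^ 2`, `x = q ^ a` and `y = q ^ (n + a)`. Up to the factor `wzScale q a`, the Dougall
term `F (n + a, k)` is `wzWeight s x n * wzKernel s y k`, which together with
`wzWeight s x n * wzMate s y k` forms a WZ pair. Telescoping in `k` turns the sum over `k` at level
`n` into the sum at level `n + 1` plus the boundary term at `k = 0`; telescoping in `n` then
expresses the sum of the boundary terms as the difference of the sum over `k` at level `0` and the
limit of those sums at level `n → ∞`.

That limit is `wzConst s x * ∑ s ^ k / (s; q)_{k + 1}`. The Rogers–Fine identity turns its series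
into `∑ q ^ (n ^ 2 + n) / (s; q)_{n + 1} ^ 2`, and Bailey's lemma for a Bailey pair relative to `q`
turns this into the alternating series.

The pair has no singularity at `a = 0`: the factor `(1 - y) ^ 2` of the kernel kills the sum over
`k`, so that only the boundary terms and the limit survive, which is the `q`-analogue of Guillera's
formula. As `q → 1` the value of `Γ_{q ^ 2}(1 / 2) ^ 2` is a `q`-Wallis product that tends to `π`,
and the alternating series tends to Leibniz's `π / 4`.
-/

open Asymptotics

/-! ### `q`-shifted factorials -/

section QPochhammer

variable {a q : ℂ}

theorem qPoch_zero (a q : ℂ) : qPoch a q 0 = 1 := Finset.prod_range_zero _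

theorem qPoch_succ (a q : ℂ) (n : ℕ) : qPoch a q (n + 1) = qPoch a q n * (1 - a * q ^ n) :=
  Finset.prod_range_succ _ n

theorem qPoch_add (a q : ℂ) (m n : ℕ) :
    qPoch a q (m + n) = qPoch a q m * qPoch (a * q ^ m) q n := by
  simp only [qPoch, Finset.prod_range_add, pow_add, mul_assoc]

theorem qPoch_succ' (a q : ℂ) (n : ℕ) : qPoch a q (n + 1) = (1 - a) * qPoch (a * q) q n := by
  simp only [qPoch, Finset.prod_range_succ', pow_succ', pow_zero, mul_one, mul_assoc, mul_comm]

theorem qPoch_ne_zero (h : ∀ i : ℕ, 1 - a * q ^ i ≠ 0) (n : ℕ) : qPoch a q n ≠ 0 :=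
  Finset.prod_ne_zero_iff.2 fun i _ => h i

theorem one_sub_ne_zero_of_norm_lt_one {z : ℂ} (hz : ‖z‖ < 1) : 1 - z ≠ 0 :=
  sub_ne_zero.2 fun h => by simp [← h] at hz

theorem one_sub_mul_pow_ne_zero (ha : ‖a‖ < 1) (hq : ‖q‖ < 1) (i : ℕ) : 1 - a * q ^ i ≠ 0 := by
  refine one_sub_ne_zero_of_norm_lt_one ?_
  rw [norm_mul, norm_pow]
  exact mul_lt_one_of_nonneg_of_lt_one_left (norm_nonneg _) ha
    (pow_le_one₀ (norm_nonneg _) hq.le)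

theorem summable_norm_neg_mul_pow (a : ℂ) (hq : ‖q‖ < 1) :
    Summable fun i : ℕ => ‖-(a * q ^ i)‖ := by
  simpa using (summable_geometric_of_lt_one (norm_nonneg q) hq).mul_left ‖a‖

theorem multipliable_one_sub_mul_pow (a : ℂ) (hq : ‖q‖ < 1) :
    Multipliable fun i : ℕ => 1 - a * q ^ i := by
  simpa [sub_eq_add_neg] using multipliable_one_add_of_summable (summable_norm_neg_mul_pow a hq)

theorem tendsto_qPoch (a : ℂ) (hq : ‖q‖ < 1) : Tendsto (qPoch a q) atTop (𝓝 (qPochInf a q)) :=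
  (multipliable_one_sub_mul_pow a hq).hasProd.tendsto_prod_nat

theorem qPochInf_ne_zero (hq : ‖q‖ < 1) (h : ∀ i : ℕ, 1 - a * q ^ i ≠ 0) :
    qPochInf a q ≠ 0 := by
  have := tprod_one_add_ne_zero_of_summable (f := fun i : ℕ => -(a * q ^ i))
    (fun i => by simpa [sub_eq_add_neg] using h i) (summable_norm_neg_mul_pow a hq)
  simpa [qPochInf, sub_eq_add_neg] using this

theorem qPochInf_eq_mul (a : ℂ) (hq : ‖q‖ < 1) (n : ℕ) :
    qPochInf a q = qPoch a q n * qPochInf (a * q ^ n) q := by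
  refine tendsto_nhds_unique
    ((tendsto_add_atTop_iff_nat n).2 (tendsto_qPoch a hq)) ?_
  simp_rw [add_comm _ n, qPoch_add]
  exact (tendsto_qPoch _ hq).const_mul _

theorem norm_qPoch_le (a : ℂ) (hq : ‖q‖ < 1) (n : ℕ) :
    ‖qPoch a q n‖ ≤ Real.exp (‖a‖ / (1 - ‖q‖)) := by
  have hfactor (i : ℕ) : ‖1 - a * q ^ i‖ ≤ Real.exp (‖a‖ * ‖q‖ ^ i) :=
    calc ‖1 - a * q ^ i‖ ≤ ‖a‖ * ‖q‖ ^ i + 1 := by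
          simpa [add_comm] using norm_sub_le (1 : ℂ) (a * q ^ i)
      _ ≤ _ := Real.add_one_le_exp _
  have hsum : ∑ i ∈ Finset.range n, ‖a‖ * ‖q‖ ^ i ≤ ‖a‖ / (1 - ‖q‖) := by
    rw [div_eq_mul_inv, ← tsum_geometric_of_lt_one (norm_nonneg q) hq, ← tsum_mul_left]
    exact ((summable_geometric_of_lt_one (norm_nonneg q) hq).mul_left _).sum_le_tsum _
      fun i _ => by positivity
  calc ‖qPoch a q n‖ = ∏ i ∈ Finset.range n, ‖1 - a * q ^ i‖ := norm_prod _ _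
    _ ≤ ∏ i ∈ Finset.range n, Real.exp (‖a‖ * ‖q‖ ^ i) :=
      Finset.prod_le_prod (fun i _ => norm_nonneg _) fun i _ => hfactor i
    _ = Real.exp (∑ i ∈ Finset.range n, ‖a‖ * ‖q‖ ^ i) := (Real.exp_sum _ _).symm
    _ ≤ _ := Real.exp_le_exp.2 hsum

theorem isBigO_one_of_tendsto {u : ℕ → ℂ} {l : ℂ} (h : Tendsto u atTop (𝓝 l)) :
    u =O[⊤] fun _ => (1 : ℝ) := by
  obtain ⟨C, hC⟩ := (Metric.isBounded_range_of_tendsto u h).exists_norm_le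
  exact isBigO_top.2 ⟨C, fun n => by simpa using hC _ ⟨n, rfl⟩⟩

theorem norm_mul_pow_le (a : ℂ) (hq : ‖q‖ < 1) (n : ℕ) : ‖a * q ^ n‖ ≤ ‖a‖ := by
  rw [norm_mul, norm_pow]
  exact mul_le_of_le_one_right (norm_nonneg _) (pow_le_one₀ (norm_nonneg _) hq.le)

theorem norm_sq_lt_one {s : ℂ} (hs : ‖s‖ < 1) : ‖s ^ 2‖ < 1 := by
  simpa using pow_lt_one₀ (norm_nonneg s) hs two_ne_zero

theorem isBigO_pow_of_le {ι : Type*} (hq : ‖q‖ < 1) {m n : ι → ℕ} (h : ∀ i, m i ≤ n i) :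
    (fun i => q ^ n i) =O[⊤] fun i => ‖q‖ ^ m i :=
  .of_norm_le fun i => by
    rw [norm_pow]
    exact pow_le_pow_of_le_one (norm_nonneg _) hq.le (h i)

theorem summable_of_isBigO_norm_pow {u : ℕ → ℂ} (hq : ‖q‖ < 1)
    (hu : u =O[⊤] fun n => ‖q‖ ^ n) : Summable u :=
  summable_of_isBigO_nat (summable_geometric_of_lt_one (norm_nonneg q) hq) (hu.mono le_top)

theorem isBigO_qPoch {ι : Type*} (a : ℂ) (hq : ‖q‖ < 1) (m n : ι → ℕ) :
    (fun i => qPoch (a * q ^ m i) q (n i)) =O[⊤] fun _ => (1 : ℝ) := by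
  refine isBigO_top.2 ⟨Real.exp (‖a‖ / (1 - ‖q‖)), fun i => ?_⟩
  rw [norm_one, mul_one]
  exact (norm_qPoch_le _ hq _).trans <| Real.exp_le_exp.2 <|
    div_le_div_of_nonneg_right (norm_mul_pow_le a hq _) (sub_nonneg.2 hq.le)

theorem isBigO_inv_qPoch {ι : Type*} (hq : ‖q‖ < 1) (h : ∀ i : ℕ, 1 - a * q ^ i ≠ 0)
    (m n : ι → ℕ) : (fun i => (qPoch (a * q ^ m i) q (n i))⁻¹) =O[⊤] fun _ => (1 : ℝ) := by
  have hshift (i : ι) : qPoch a q (m i) * (qPoch a q (m i + n i))⁻¹ =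
      (qPoch (a * q ^ m i) q (n i))⁻¹ := by
    rw [qPoch_add, mul_inv, mul_inv_cancel_left₀ (qPoch_ne_zero h _)]
  have hpoch : (fun i => qPoch a q (m i)) =O[⊤] fun _ => (1 : ℝ) := by
    simpa using isBigO_qPoch a hq (fun _ => 0) m
  have hinv := (isBigO_one_of_tendsto ((tendsto_qPoch a hq).inv₀
    (qPochInf_ne_zero hq h))).comp_tendsto (l' := ⊤) (k := fun i => m i + n i) tendsto_top
  exact (hpoch.mul hinv).congr hshift fun _ => mul_one _

theorem tendsto_one_sub_mul_pow (a : ℂ) (hq : ‖q‖ < 1) :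
    Tendsto (fun n : ℕ => 1 - a * q ^ n) atTop (𝓝 1) := by
  simpa using ((tendsto_pow_atTop_nhds_zero_of_norm_lt_one hq).const_mul a).const_sub 1

end QPochhammer

/-! ### The WZ pair -/

section WZPair

/-- The first member of the WZ pair in base `q = s ^ 2`, as a function of `y = q ^ (n + a)` and
`k`, without the factor `wzWeight` that does not depend on `k`. The factor
`(1 - y) ^ 3 / (1 - y ^ 3)` is written `(1 - y) ^ 2 / (1 + y + y ^ 2)` so that it makes sense at
`y = 1`. -/
noncomputable def wzKernel (s y : ℂ) (k : ℕ) : ℂ :=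
  s ^ k * qPoch (y * s) (s ^ 2) k ^ 3 * qPoch (y ^ 3) (s ^ 2) k *
      (1 - s * y ^ 3 * (s ^ 2) ^ (2 * k)) * (1 - y) ^ 2 /
    ((1 + y + y ^ 2) * qPoch (y ^ 2 * s ^ 2) (s ^ 2) k ^ 3 * qPoch s (s ^ 2) (k + 1))

/-- The quotient of consecutive values of `wzWeight`. -/
noncomputable def wzRatio (s y : ℂ) : ℂ :=
  (1 - y * s) ^ 6 * qPoch (y ^ 3 * s ^ 2) (s ^ 2) 3 /
    ((1 - y * s ^ 2) ^ 3 * qPoch (y ^ 2 * s ^ 2) (s ^ 2) 2 ^ 3)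

/-- The `k`-independent factor of the WZ pair in base `q = s ^ 2`, with `x = q ^ a`. -/
noncomputable def wzWeight (s x : ℂ) (n : ℕ) : ℂ :=
  qPoch (x * s) (s ^ 2) n ^ 6 * qPoch (x ^ 3 * s ^ 2) (s ^ 2) (3 * n) /
    (qPoch (x * s ^ 2) (s ^ 2) n ^ 3 * qPoch (x ^ 2 * s ^ 2) (s ^ 2) (2 * n) ^ 3)

/-- The polynomial factor of the second member of the WZ pair, in `y = q ^ (n + a)` and
`t = q ^ k`. Its coefficients are those of the certificate that the `q`-Zeilberger algorithm
produces for `wzKernel`. -/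
def certPoly (s y t : ℂ) : ℂ :=
  (-3 * y + 3 * y ^ 2 + 3 * y ^ 2 * s - y ^ 3 - y ^ 3 * s - y ^ 3 * s ^ 2)
    + (3 * y ^ 2 * s + y ^ 3 - y ^ 3 * s - 6 * y ^ 4 * s ^ 2 - 3 * y ^ 5 * s + 3 * y ^ 5 * s ^ 2
      + y ^ 6 * s + y ^ 6 * s ^ 2 + y ^ 6 * s ^ 4) * t
    + (-y ^ 3 * s ^ 2 - 3 * y ^ 5 * s - 3 * y ^ 5 * s ^ 2 - 3 * y ^ 5 * s ^ 4 + y ^ 6 * s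
      + 9 * y ^ 6 * s ^ 2 + 9 * y ^ 6 * s ^ 4 + y ^ 6 * s ^ 5 - 3 * y ^ 7 * s ^ 2
      - 3 * y ^ 7 * s ^ 4 - 3 * y ^ 7 * s ^ 5 - y ^ 9 * s ^ 4) * t ^ 2
    + (y ^ 6 * s ^ 2 + y ^ 6 * s ^ 4 + y ^ 6 * s ^ 5 + 3 * y ^ 7 * s ^ 4 - 3 * y ^ 7 * s ^ 5
      - 6 * y ^ 8 * s ^ 4 - y ^ 9 * s ^ 5 + y ^ 9 * s ^ 6 + 3 * y ^ 10 * s ^ 5) * t ^ 3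
    + (-y ^ 9 * s ^ 4 - y ^ 9 * s ^ 5 - y ^ 9 * s ^ 6 + 3 * y ^ 10 * s ^ 5 + 3 * y ^ 10 * s ^ 6
      - 3 * y ^ 11 * s ^ 6) * t ^ 4

/-- The second member of the WZ pair at `k + 1`, without the factor `wzWeight`. -/
noncomputable def wzMate (s y : ℂ) (k : ℕ) : ℂ :=
  s ^ (k + 1) * certPoly s y ((s ^ 2) ^ (k + 1)) * qPoch (y * s) (s ^ 2) (k + 1) ^ 3 *
      qPoch (y ^ 3 * s ^ 2) (s ^ 2) k /
    (qPoch s (s ^ 2) (k + 1) * qPoch (y ^ 2 * s ^ 2) (s ^ 2) (k + 2) ^ 3)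

/-- The second member of the WZ pair at `k = 0`, without the factor `wzWeight`. -/
noncomputable def wzMateZero (s y : ℂ) : ℂ :=
  y * polyP (s ^ 2) s y / ((1 - y ^ 2 * s ^ 2) ^ 3 * (1 + y + y ^ 2))

/-- The parameters `s` and `y` for which the WZ pair in base `q = s ^ 2` has no vanishing
denominator; `y ^ 2 = 1` and `y ^ 3 = 1` are allowed as long as `1 + y + y ^ 2 ≠ 0`. -/
structure WZParam (s y : ℂ) : Prop where
  norm_lt : ‖s‖ < 1
  sq_ne : ∀ i : ℕ, 1 - y ^ 2 * s ^ 2 * (s ^ 2) ^ i ≠ 0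
  cube_ne : ∀ i : ℕ, 1 - y ^ 3 * s ^ 2 * (s ^ 2) ^ i ≠ 0
  quad_ne : 1 + y + y ^ 2 ≠ 0

theorem certPoly_identity (s y t : ℂ) :
    (1 - s * y ^ 3 * s ^ 6 * t ^ 2) * (1 - y * s * t) ^ 3 * (1 - y * s) ^ 3 *
        (1 - y ^ 3 * t * s ^ 2) * (1 - y ^ 3 * t * s ^ 4) * (1 - y ^ 3 * t) -
      (1 - s * y ^ 3 * t ^ 2) * (1 - y) ^ 3 *
        ((1 - y ^ 2 * t * s ^ 2) ^ 3 * (1 - y ^ 2 * t * s ^ 4) ^ 3) =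
    s * certPoly s y (t * s ^ 2) * (1 - y * s * t) ^ 3 * (1 - y ^ 3 * t) -
      (1 - s * t) * certPoly s y t * (1 - y ^ 2 * t * s ^ 4) ^ 3 := by
  unfold certPoly
  ring

theorem polyP_identity (s y : ℂ) :
    (1 - s * y ^ 3 * s ^ 6) * (1 - y * s) ^ 3 * (1 - y * s) ^ 3 *
        (1 - y ^ 3 * s ^ 2) * (1 - y ^ 3 * s ^ 4) * (1 + y + y ^ 2) -
      (1 - s * y ^ 3) * (1 - y) ^ 2 * ((1 - y ^ 2 * s ^ 2) ^ 3 * (1 - y ^ 2 * s ^ 4) ^ 3) =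
    s * certPoly s y (s ^ 2) * (1 - y * s) ^ 3 * (1 + y + y ^ 2) -
      (1 - s) * (y * polyP (s ^ 2) s y) * (1 - y ^ 2 * s ^ 4) ^ 3 := by
  unfold certPoly polyP
  ring

namespace WZParam

variable {s y : ℂ}

theorem norm_sq_lt (h : WZParam s y) : ‖s ^ 2‖ < 1 := norm_sq_lt_one h.norm_lt

theorem qPoch_s_ne (h : WZParam s y) (n : ℕ) : qPoch s (s ^ 2) n ≠ 0 :=
  qPoch_ne_zero (one_sub_mul_pow_ne_zero h.norm_lt h.norm_sq_lt) n

theorem mul_sq_ne (h : WZParam s y) (i : ℕ) : 1 - y * s ^ 2 * (s ^ 2) ^ i ≠ 0 := fun h0 =>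
  h.cube_ne (3 * i + 2) <| by
    linear_combination (1 + y * s ^ 2 * (s ^ 2) ^ i + (y * s ^ 2 * (s ^ 2) ^ i) ^ 2) * h0

theorem quad_mul_sq_ne (h : WZParam s y) : 1 + y * s ^ 2 + (y * s ^ 2) ^ 2 ≠ 0 := fun h0 =>
  h.cube_ne 2 <| by linear_combination (1 - y * s ^ 2) * h0

theorem mul_sq (h : WZParam s y) : WZParam s (y * s ^ 2) where
  norm_lt := h.norm_lt
  sq_ne i := by convert h.sq_ne (i + 2) using 1; ring
  cube_ne i := by convert h.cube_ne (i + 3) using 1; ring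
  quad_ne := h.quad_mul_sq_ne

theorem mul_pow (h : WZParam s y) (n : ℕ) : WZParam s (y * (s ^ 2) ^ n) := by
  induction n with
  | zero => simpa using h
  | succ n ih => simpa only [pow_succ, mul_assoc] using ih.mul_sq

end WZParam

theorem wzKernel_succ {y : ℂ} (hy : 1 + y + y ^ 2 ≠ 0) (s : ℂ) (k : ℕ) :
    wzKernel s y (k + 1) = s ^ (k + 1) * qPoch (y * s) (s ^ 2) (k + 1) ^ 3 *
        qPoch (y ^ 3 * s ^ 2) (s ^ 2) k * (1 - s * y ^ 3 * (s ^ 2) ^ (2 * (k + 1))) * (1 - y) ^ 3 /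
      (qPoch (y ^ 2 * s ^ 2) (s ^ 2) (k + 1) ^ 3 * qPoch s (s ^ 2) (k + 2)) := by
  rw [wzKernel, qPoch_succ' (y ^ 3)]
  field_simp
  ring

theorem wzRatio_mul_wzKernel {s y : ℂ} (h : WZParam s y) (k : ℕ) :
    wzRatio s y * wzKernel s (y * s ^ 2) k =
      s ^ k * qPoch (y * s) (s ^ 2) (k + 1) ^ 3 * (1 - y * s) ^ 3 *
          qPoch (y ^ 3 * s ^ 2) (s ^ 2) (k + 2) * (1 - s * y ^ 3 * (s ^ 2) ^ (2 * k + 3)) /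
        (qPoch (y ^ 2 * s ^ 2) (s ^ 2) (k + 2) ^ 3 * qPoch s (s ^ 2) (k + 1)) := by
  have hy : 1 - y * s ^ 2 ≠ 0 := by simpa using h.mul_sq_ne 0
  have hquad := h.quad_mul_sq_ne
  have hsq := qPoch_ne_zero h.sq_ne (2 + k)
  have hnum : qPoch (y * s) (s ^ 2) (k + 1) = (1 - y * s) * qPoch (y * s ^ 2 * s) (s ^ 2) k := by
    rw [qPoch_succ', show y * s * s ^ 2 = y * s ^ 2 * s by ring]
  have hden : qPoch (y ^ 2 * s ^ 2) (s ^ 2) (2 + k) =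
      qPoch (y ^ 2 * s ^ 2) (s ^ 2) 2 * qPoch ((y * s ^ 2) ^ 2 * s ^ 2) (s ^ 2) k := by
    rw [qPoch_add, show y ^ 2 * s ^ 2 * (s ^ 2) ^ 2 = (y * s ^ 2) ^ 2 * s ^ 2 by ring]
  have hcube : qPoch (y ^ 3 * s ^ 2) (s ^ 2) (2 + k) =
      qPoch (y ^ 3 * s ^ 2) (s ^ 2) 2 * qPoch ((y * s ^ 2) ^ 3) (s ^ 2) k := by
    rw [qPoch_add, show y ^ 3 * s ^ 2 * (s ^ 2) ^ 2 = (y * s ^ 2) ^ 3 by ring]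
  have hthree : qPoch (y ^ 3 * s ^ 2) (s ^ 2) 3 = qPoch (y ^ 3 * s ^ 2) (s ^ 2) 2 *
      ((1 - y * s ^ 2) * (1 + y * s ^ 2 + (y * s ^ 2) ^ 2)) := by
    rw [qPoch_succ]
    ring
  rw [hden] at hsq
  rw [add_comm k 2, hden, hcube, hnum, wzRatio, wzKernel, hthree]
  generalize 1 + y * s ^ 2 + (y * s ^ 2) ^ 2 = Q at hquad ⊢
  field_simp
  ring

theorem wzKernel_wz_succ {s y : ℂ} (h : WZParam s y) (k : ℕ) :
    wzRatio s y * wzKernel s (y * s ^ 2) (k + 1) - wzKernel s y (k + 1) =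
      wzMate s y (k + 1) - wzMate s y k := by
  set t := (s ^ 2) ^ (k + 1) with ht
  have hsq₃ : qPoch (y ^ 2 * s ^ 2) (s ^ 2) (k + 3) = qPoch (y ^ 2 * s ^ 2) (s ^ 2) (k + 1) *
    (1 - y ^ 2 * t * s ^ 2) * (1 - y ^ 2 * t * s ^ 4) := by rw [qPoch_succ, qPoch_succ]; ring
  have hsq₂ : qPoch (y ^ 2 * s ^ 2) (s ^ 2) (k + 2) =
    qPoch (y ^ 2 * s ^ 2) (s ^ 2) (k + 1) * (1 - y ^ 2 * t * s ^ 2) := by rw [qPoch_succ]; ring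
  have hs₂ : qPoch s (s ^ 2) (k + 2) = qPoch s (s ^ 2) (k + 1) * (1 - s * t) := qPoch_succ _ _ _
  have hcube₁ : qPoch (y ^ 3 * s ^ 2) (s ^ 2) (k + 1) =
    qPoch (y ^ 3 * s ^ 2) (s ^ 2) k * (1 - y ^ 3 * t) := by rw [qPoch_succ]; ring
  have hcube₃ : qPoch (y ^ 3 * s ^ 2) (s ^ 2) (k + 3) = qPoch (y ^ 3 * s ^ 2) (s ^ 2) (k + 1) *
    (1 - y ^ 3 * t * s ^ 2) * (1 - y ^ 3 * t * s ^ 4) := by rw [qPoch_succ, qPoch_succ]; ring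
  have hhalf₂ : qPoch (y * s) (s ^ 2) (k + 2) = qPoch (y * s) (s ^ 2) (k + 1) * (1 - y * s * t) :=
    qPoch_succ _ _ _
  have hsq := qPoch_ne_zero h.sq_ne (k + 3)
  have hs := h.qPoch_s_ne (k + 2)
  simp only [hsq₃, hs₂, mul_ne_zero_iff] at hsq hs
  obtain ⟨⟨hsq₁, hU⟩, hV⟩ := hsq
  obtain ⟨hs₁, hW⟩ := hs
  have key := certPoly_identity s y t
  rw [wzRatio_mul_wzKernel h, wzKernel_succ h.quad_ne, wzMate, wzMate, hsq₃, hsq₂, hs₂, hcube₃,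
    hcube₁, hhalf₂, show (s ^ 2) ^ (2 * (k + 1) + 3) = s ^ 6 * t ^ 2 by ring,
    show (s ^ 2) ^ (2 * (k + 1)) = t ^ 2 by ring, show (s ^ 2) ^ (k + 1 + 1) = t * s ^ 2 by ring,
    ← ht]
  generalize 1 - y ^ 2 * t * s ^ 2 = U at key hU ⊢
  generalize 1 - y ^ 2 * t * s ^ 4 = V at key hV ⊢
  generalize 1 - s * t = W at key hW ⊢
  generalize certPoly s y (t * s ^ 2) = N at key ⊢
  generalize certPoly s y t = N' at key ⊢
  field_simp
  linear_combination s ^ (k + 1) * qPoch (y * s) (s ^ 2) (k + 1) ^ 3 *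
    qPoch (y ^ 3 * s ^ 2) (s ^ 2) k * key

theorem wzKernel_wz_zero {s y : ℂ} (h : WZParam s y) :
    wzRatio s y * wzKernel s (y * s ^ 2) 0 - wzKernel s y 0 = wzMate s y 0 - wzMateZero s y := by
  have h1 : 1 - y ^ 2 * s ^ 2 ≠ 0 := by simpa using h.sq_ne 0
  have h2 : 1 - y ^ 2 * s ^ 4 ≠ 0 := by convert h.sq_ne 1 using 1; ring
  have hs : 1 - s ≠ 0 := one_sub_ne_zero_of_norm_lt_one h.norm_lt
  have hquad := h.quad_ne
  have hpoch₂ : qPoch (y ^ 2 * s ^ 2) (s ^ 2) 2 = (1 - y ^ 2 * s ^ 2) * (1 - y ^ 2 * s ^ 4) := by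
    rw [qPoch_succ, qPoch_succ, qPoch_zero]; ring
  have hcube₂ : qPoch (y ^ 3 * s ^ 2) (s ^ 2) 2 = (1 - y ^ 3 * s ^ 2) * (1 - y ^ 3 * s ^ 4) := by
    rw [qPoch_succ, qPoch_succ, qPoch_zero]; ring
  rw [wzRatio_mul_wzKernel h, wzKernel, wzMate, wzMateZero, zero_add, hpoch₂, hcube₂]
  simp only [qPoch_succ, qPoch_zero, pow_zero, zero_add, one_mul, mul_one, mul_zero, pow_one,
    one_pow]
  field_simp
  linear_combination polyP_identity s y

end WZPair

/-! ### Summing the WZ pair -/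

section WZSum

variable {s x y : ℂ}

/-- The limit of `wzWeight`. -/
noncomputable def wzConst (s x : ℂ) : ℂ :=
  qPochInf (x * s) (s ^ 2) ^ 6 * qPochInf (x ^ 3 * s ^ 2) (s ^ 2) /
    (qPochInf (x * s ^ 2) (s ^ 2) ^ 3 * qPochInf (x ^ 2 * s ^ 2) (s ^ 2) ^ 3)

theorem wzWeight_succ (s x : ℂ) (n : ℕ) :
    wzWeight s x (n + 1) = wzWeight s x n * wzRatio s (x * (s ^ 2) ^ n) := by
  have hsq : (x * (s ^ 2) ^ n) ^ 2 * s ^ 2 = x ^ 2 * s ^ 2 * (s ^ 2) ^ (2 * n) := by ring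
  have hcube : (x * (s ^ 2) ^ n) ^ 3 * s ^ 2 = x ^ 3 * s ^ 2 * (s ^ 2) ^ (3 * n) := by ring
  rw [wzWeight, wzWeight, wzRatio, hsq, hcube, div_mul_div_comm, mul_add, mul_add, mul_one,
    mul_one, qPoch_add _ _ (3 * n), qPoch_add _ _ (2 * n), qPoch_succ (x * s),
    qPoch_succ (x * s ^ 2)]
  congr 1 <;> ring

theorem tendsto_mul_pow_zero {q : ℂ} (x : ℂ) (hq : ‖q‖ < 1) :
    Tendsto (fun n : ℕ => x * q ^ n) atTop (𝓝 0) := by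
  simpa using (tendsto_pow_atTop_nhds_zero_of_norm_lt_one hq).const_mul x

namespace WZParam

theorem tendsto_wzWeight (h : WZParam s x) :
    Tendsto (wzWeight s x) atTop (𝓝 (wzConst s x)) := by
  have hq := h.norm_sq_lt
  have hmul (c : ℕ) (hc : 0 < c) : Tendsto (fun n : ℕ => c * n) atTop atTop :=
    tendsto_id.const_mul_atTop' hc
  refine Tendsto.div ((tendsto_qPoch _ hq).pow 6 |>.mul
    ((tendsto_qPoch _ hq).comp (hmul 3 three_pos))) (((tendsto_qPoch _ hq).pow 3).mul
    (((tendsto_qPoch _ hq).comp (hmul 2 two_pos)).pow 3)) ?_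
  exact mul_ne_zero (pow_ne_zero _ (qPochInf_ne_zero hq h.mul_sq_ne))
    (pow_ne_zero _ (qPochInf_ne_zero hq h.sq_ne))

theorem isBigO_inv_quad (h : WZParam s x) :
    (fun n : ℕ => (1 + x * (s ^ 2) ^ n + (x * (s ^ 2) ^ n) ^ 2)⁻¹) =O[⊤] fun _ => (1 : ℝ) := by
  have ht := tendsto_mul_pow_zero x h.norm_sq_lt
  exact isBigO_one_of_tendsto (((ht.const_add 1).add (ht.pow 2)).inv₀ (by simp))

theorem isBigO_wzKernel (h : WZParam s x) :
    (fun p : ℕ × ℕ => wzKernel s (x * (s ^ 2) ^ p.1) p.2) =O[⊤] fun p => ‖s‖ ^ p.2 := by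
  have hq := h.norm_sq_lt
  have hkernel (p : ℕ × ℕ) : s ^ p.2 * qPoch (x * s * (s ^ 2) ^ p.1) (s ^ 2) p.2 ^ 3 *
      qPoch (x ^ 3 * (s ^ 2) ^ (3 * p.1)) (s ^ 2) p.2 *
      qPoch (s * x ^ 3 * (s ^ 2) ^ (3 * p.1 + 2 * p.2)) (s ^ 2) 1 *
      qPoch (x * (s ^ 2) ^ p.1) (s ^ 2) 1 ^ 2 *
      ((1 + x * (s ^ 2) ^ p.1 + (x * (s ^ 2) ^ p.1) ^ 2)⁻¹ *
        (qPoch (x ^ 2 * s ^ 2 * (s ^ 2) ^ (2 * p.1)) (s ^ 2) p.2)⁻¹ ^ 3 *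
        (qPoch (s * (s ^ 2) ^ 0) (s ^ 2) (p.2 + 1))⁻¹) = wzKernel s (x * (s ^ 2) ^ p.1) p.2 := by
    rw [wzKernel, div_eq_mul_inv, mul_inv, mul_inv, ← inv_pow,
      show (x * (s ^ 2) ^ p.1) ^ 3 = x ^ 3 * (s ^ 2) ^ (3 * p.1) by ring,
      show x * (s ^ 2) ^ p.1 * s = x * s * (s ^ 2) ^ p.1 by ring,
      show (x * (s ^ 2) ^ p.1) ^ 2 * s ^ 2 = x ^ 2 * s ^ 2 * (s ^ 2) ^ (2 * p.1) by ring]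
    simp only [qPoch_succ, qPoch_zero, pow_add, pow_zero, mul_one, one_mul, mul_assoc]
  have hpow : (fun p : ℕ × ℕ => s ^ p.2) =O[⊤] fun p => ‖s‖ ^ p.2 :=
    .of_norm_le fun p => (norm_pow s p.2).le
  have hquad := h.isBigO_inv_quad.comp_tendsto (l' := ⊤) (k := Prod.fst (β := ℕ)) tendsto_top
  have hsq := isBigO_inv_qPoch hq h.sq_ne (fun p : ℕ × ℕ => 2 * p.1) Prod.snd
  have hs := isBigO_inv_qPoch hq (one_sub_mul_pow_ne_zero h.norm_lt hq) (fun _ : ℕ × ℕ => 0)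
    fun p => p.2 + 1
  exact (((((hpow.mul ((isBigO_qPoch _ hq _ _).pow 3)).mul (isBigO_qPoch _ hq _ _)).mul
    (isBigO_qPoch _ hq _ _)).mul ((isBigO_qPoch _ hq _ _).pow 2)).mul
    ((hquad.mul (hsq.pow 3)).mul hs)).congr hkernel fun p => by simp

theorem summable_wzKernel (h : WZParam s x) : Summable (wzKernel s x) := by
  have hO : wzKernel s x =O[⊤] fun k => ‖s‖ ^ k := by
    simpa using h.isBigO_wzKernel.comp_tendsto (l' := ⊤) (k := fun k : ℕ => ((0 : ℕ), k))
      tendsto_top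
  exact summable_of_isBigO_norm_pow h.norm_lt hO

theorem tendsto_wzMate (h : WZParam s x) : Tendsto (wzMate s x) atTop (𝓝 0) := by
  have hq := h.norm_sq_lt
  have hs := one_sub_mul_pow_ne_zero h.norm_lt hq
  have hcert : Tendsto (fun k : ℕ => certPoly s x ((s ^ 2) ^ (k + 1))) atTop
      (𝓝 (certPoly s x 0)) := by
    have hcont : Continuous (certPoly s x) := by unfold certPoly; fun_prop
    exact (hcont.tendsto 0).comp ((tendsto_add_atTop_iff_nat 1).2
      (tendsto_pow_atTop_nhds_zero_of_norm_lt_one hq))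
  have hpow := (tendsto_add_atTop_iff_nat 1).2
    (tendsto_pow_atTop_nhds_zero_of_norm_lt_one h.norm_lt)
  have hpoch (a : ℂ) (m : ℕ) := (tendsto_add_atTop_iff_nat m).2 (tendsto_qPoch a hq)
  have hlim := (((hpow.mul hcert).mul ((hpoch (x * s) 1).pow 3)).mul
    (hpoch (x ^ 3 * s ^ 2) 0)).div
    ((hpoch _ 1).mul ((hpoch _ 2).pow 3))
    (mul_ne_zero (qPochInf_ne_zero hq hs) (pow_ne_zero 3 (qPochInf_ne_zero hq h.sq_ne)))
  rwa [zero_mul, zero_mul, zero_mul, zero_div] at hlim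

theorem wzRatio_mul_tsum (h : WZParam s y) :
    wzRatio s y * ∑' k, wzKernel s (y * s ^ 2) k = ∑' k, wzKernel s y k - wzMateZero s y := by
  have hsum := (h.mul_sq.summable_wzKernel.mul_left (wzRatio s y)).sub h.summable_wzKernel
  have hpartial (n : ℕ) : ∑ k ∈ Finset.range (n + 1), (wzRatio s y * wzKernel s (y * s ^ 2) k -
      wzKernel s y k) = wzMate s y n - wzMateZero s y := by
    rw [Finset.sum_range_succ', wzKernel_wz_zero h,
      Finset.sum_congr rfl fun k _ => wzKernel_wz_succ h k, Finset.sum_range_sub]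
    ring
  have hlim : Tendsto (fun n => wzMate s y n - wzMateZero s y) atTop
      (𝓝 (∑' k, (wzRatio s y * wzKernel s (y * s ^ 2) k - wzKernel s y k))) :=
    ((tendsto_add_atTop_iff_nat 1).2 hsum.tendsto_sum_tsum_nat).congr hpartial
  have hvalue := tendsto_nhds_unique hlim (h.tendsto_wzMate.sub_const _)
  rw [(h.mul_sq.summable_wzKernel.mul_left _).tsum_sub h.summable_wzKernel, tsum_mul_left]
    at hvalue
  linear_combination hvalue

theorem sum_wzWeight_mul_wzMateZero (h : WZParam s x) (N : ℕ) :
    ∑ n ∈ Finset.range N, wzWeight s x n * wzMateZero s (x * (s ^ 2) ^ n) =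
      ∑' k, wzKernel s x k - wzWeight s x N * ∑' k, wzKernel s (x * (s ^ 2) ^ N) k := by
  induction N with
  | zero => simp [wzWeight, qPoch_zero]
  | succ N ih =>
    rw [Finset.sum_range_succ, ih, wzWeight_succ, pow_succ (s ^ 2), ← mul_assoc x]
    linear_combination wzWeight s x N * (h.mul_pow N).wzRatio_mul_tsum

theorem tendsto_tsum_wzKernel (h : WZParam s x) :
    Tendsto (fun n : ℕ => ∑' k, wzKernel s (x * (s ^ 2) ^ n) k) atTop
      (𝓝 (∑' k, s ^ k / qPoch s (s ^ 2) (k + 1))) := by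
  obtain ⟨C, hC⟩ := isBigO_top.1 h.isBigO_wzKernel
  refine tendsto_tsum_of_dominated_convergence (bound := fun k => C * ‖s‖ ^ k)
    ((summable_geometric_of_lt_one (norm_nonneg s) h.norm_lt).mul_left C) (fun k => ?_)
    (.of_forall fun n k => by simpa using hC (n, k))
  have hcont : ContinuousAt (fun y => wzKernel s y k) 0 := by
    unfold wzKernel qPoch
    refine ContinuousAt.div (by fun_prop) (by fun_prop) ?_
    simpa [qPoch] using h.qPoch_s_ne (k + 1)
  simpa [wzKernel, qPoch, Function.comp_def] using
    hcont.tendsto.comp (tendsto_mul_pow_zero x h.norm_sq_lt)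

theorem tendsto_wzWeight_mul_tsum (h : WZParam s x) :
    Tendsto (fun n : ℕ => wzWeight s x n * ∑' k, wzKernel s (x * (s ^ 2) ^ n) k) atTop
      (𝓝 (wzConst s x * ∑' k, s ^ k / qPoch s (s ^ 2) (k + 1))) :=
  h.tendsto_wzWeight.mul h.tendsto_tsum_wzKernel

theorem isBigO_wzMateZero (h : WZParam s x) :
    (fun n : ℕ => wzMateZero s (x * (s ^ 2) ^ n)) =O[⊤] fun n => ‖s ^ 2‖ ^ n := by
  have ht := tendsto_mul_pow_zero x h.norm_sq_lt
  have hcont : ContinuousAt (fun y => polyP (s ^ 2) s y /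
      ((1 - y ^ 2 * s ^ 2) ^ 3 * (1 + y + y ^ 2))) 0 := by
    unfold polyP
    exact ContinuousAt.div (by fun_prop) (by fun_prop) (by simp)
  have hpow : (fun n : ℕ => x * (s ^ 2) ^ n) =O[⊤] fun n => ‖s ^ 2‖ ^ n :=
    (IsBigO.of_norm_le fun n => (norm_pow _ n).le).const_mul_left x
  exact (hpow.mul (isBigO_one_of_tendsto (hcont.tendsto.comp ht))).congr
    (fun n => (mul_div_assoc ..).symm) fun n => mul_one _

theorem hasSum_wzWeight_mul_wzMateZero (h : WZParam s x) :
    HasSum (fun n : ℕ => wzWeight s x n * wzMateZero s (x * (s ^ 2) ^ n))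
      (∑' k, wzKernel s x k - wzConst s x * ∑' k, s ^ k / qPoch s (s ^ 2) (k + 1)) := by
  have hO : (fun n : ℕ => wzWeight s x n * wzMateZero s (x * (s ^ 2) ^ n)) =O[⊤]
      fun n => ‖s ^ 2‖ ^ n := by
    simpa using (isBigO_one_of_tendsto h.tendsto_wzWeight).mul h.isBigO_wzMateZero
  rw [(summable_of_isBigO_norm_pow h.norm_sq_lt hO).hasSum_iff_tendsto_nat]
  simp_rw [h.sum_wzWeight_mul_wzMateZero]
  exact h.tendsto_wzWeight_mul_tsum.const_sub _

end WZParam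

end WZSum

/-! ### The Rogers–Fine identity -/

section RogersFine

variable {b q t : ℂ}

theorem isBigO_pow_div_qPoch (hq : ‖q‖ < 1) (hb : ∀ i : ℕ, 1 - b * q ^ i ≠ 0) (t : ℂ) :
    (fun p : ℕ × ℕ => (t * q ^ p.1) ^ p.2 / qPoch b q (p.1 + 1 + p.2)) =O[⊤]
      fun p => ‖t‖ ^ p.2 := by
  have hpow : (fun p : ℕ × ℕ => (t * q ^ p.1) ^ p.2) =O[⊤] fun p => ‖t‖ ^ p.2 :=
    .of_norm_le fun p => by
      rw [norm_pow]
      exact pow_le_pow_left₀ (norm_nonneg _) (norm_mul_pow_le t hq _) _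
  have hinv := isBigO_inv_qPoch hq hb (fun _ : ℕ × ℕ => 0) fun p => p.1 + 1 + p.2
  simpa [div_eq_mul_inv] using hpow.mul hinv

theorem summable_pow_div_qPoch (hq : ‖q‖ < 1) (ht : ‖t‖ < 1) (hb : ∀ i : ℕ, 1 - b * q ^ i ≠ 0)
    (j : ℕ) : Summable fun k => (t * q ^ j) ^ k / qPoch b q (j + 1 + k) :=
  summable_of_isBigO_norm_pow ht
    ((isBigO_pow_div_qPoch hq hb t).comp_tendsto (l' := ⊤) (k := fun k : ℕ => (j, k)) tendsto_top)

theorem one_sub_mul_tsum_pow_div_qPoch (hq : ‖q‖ < 1) (ht : ‖t‖ < 1)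
    (hb : ∀ i : ℕ, 1 - b * q ^ i ≠ 0) (j : ℕ) :
    (1 - t * q ^ j) * ∑' k, (t * q ^ j) ^ k / qPoch b q (j + 1 + k) =
      b * t * q ^ (2 * j + 1) * ∑' k, (t * q ^ (j + 1)) ^ k / qPoch b q (j + 1 + 1 + k) +
        1 / qPoch b q (j + 1) := by
  have hsum := summable_pow_div_qPoch hq ht hb
  have hterm (k : ℕ) : (t * q ^ j) ^ (k + 1) / qPoch b q (j + 1 + (k + 1)) =
      t * q ^ j * ((t * q ^ j) ^ k / qPoch b q (j + 1 + k)) +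
        b * t * q ^ (2 * j + 1) * ((t * q ^ (j + 1)) ^ k / qPoch b q (j + 1 + 1 + k)) := by
    have h2 := hb (j + 1 + k)
    rw [← add_assoc, show j + 1 + 1 + k = j + 1 + k + 1 by ring, qPoch_succ]
    field_simp
    ring
  have hshift := (hsum j).tsum_eq_zero_add
  simp_rw [hterm] at hshift
  rw [((hsum j).mul_left _).tsum_add ((hsum (j + 1)).mul_left _), tsum_mul_left, tsum_mul_left,
    pow_zero, add_zero] at hshift
  linear_combination hshift

theorem summable_pow_mul_pow_sq (hq : ‖q‖ < 1) (z : ℂ) :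
    Summable fun n : ℕ => z ^ n * q ^ n ^ 2 := by
  have hsmall : ∀ᶠ n : ℕ in atTop, ‖z * q ^ n‖ < 1 / 2 :=
    (tendsto_mul_pow_zero z hq).norm.eventually_lt_const (by simp)
  refine summable_of_isBigO_nat summable_geometric_two (IsBigO.of_bound' ?_)
  filter_upwards [hsmall] with n hn
  rw [sq, pow_mul, ← mul_pow, norm_pow, norm_pow, Real.norm_of_nonneg one_half_pos.le]
  exact pow_le_pow_left₀ (norm_nonneg _) hn.le _

theorem hasSum_rogersFine (hq : ‖q‖ < 1) (ht : ‖t‖ < 1) (hb : ∀ i : ℕ, 1 - b * q ^ i ≠ 0) :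
    HasSum (fun n : ℕ => (b * t) ^ n * q ^ n ^ 2 / (qPoch b q (n + 1) * qPoch t q (n + 1)))
      (∑' k, t ^ k / qPoch b q (k + 1)) := by
  have ht' := one_sub_mul_pow_ne_zero ht hq
  set F : ℕ → ℂ := fun j => ∑' k, (t * q ^ j) ^ k / qPoch b q (j + 1 + k) with hF
  set K : ℕ → ℂ := fun j => (b * t) ^ j * q ^ j ^ 2 * (qPoch t q j)⁻¹ * F j with hK
  have hterm (n : ℕ) : (b * t) ^ n * q ^ n ^ 2 / (qPoch b q (n + 1) * qPoch t q (n + 1)) =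
      K n - K (n + 1) := by
    have hrec := one_sub_mul_tsum_pow_div_qPoch hq ht hb n
    have h1 := qPoch_ne_zero ht' n
    have h2 := ht' n
    simp only [hK, hF]
    rw [qPoch_succ t, show (n + 1) ^ 2 = n ^ 2 + (2 * n + 1) by ring, pow_add]
    generalize (1 - t * q ^ n) = T at *
    field_simp at hrec ⊢
    linear_combination -(b * t) ^ n * q ^ n ^ 2 * hrec
  have hFbdd : F =O[⊤] fun _ => (1 : ℝ) := by
    obtain ⟨C, hC⟩ := isBigO_top.1 (isBigO_pow_div_qPoch hq hb t)
    refine isBigO_top.2 ⟨∑' k, C * ‖t‖ ^ k, fun j => ?_⟩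
    rw [norm_one, mul_one]
    exact tsum_of_norm_bounded ((summable_geometric_of_lt_one (norm_nonneg t) ht).mul_left C).hasSum
      fun k => by simpa using hC (j, k)
  have hinv := isBigO_inv_qPoch hq ht' (fun _ : ℕ => 0) id
  have hsummable : Summable K := summable_of_isBigO_nat
    (summable_pow_mul_pow_sq hq (b * t)).norm (by
      simpa [hK] using (((isBigO_refl (fun n : ℕ => (b * t) ^ n * q ^ n ^ 2) ⊤).norm_right.mul
        hinv).mul hFbdd).mono le_top)
  have htelescope := hsummable.hasSum.sub ((hasSum_nat_add_iff' 1).2 hsummable.hasSum)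
  simpa [hterm, hK, hF, qPoch_zero, add_comm] using htelescope

end RogersFine

/-! ### Bailey pairs -/

section Bailey

variable {q s : ℂ} {α β : ℕ → ℂ}

/-- The summand of Cauchy's series for `1 / (q; q)_∞`. -/
noncomputable def cauchyTerm (q : ℂ) (N m : ℕ) : ℂ :=
  q ^ (m ^ 2 + N * m) / (qPoch q q m * qPoch q q (N + m))

theorem isBigO_cauchyTerm (hq : ‖q‖ < 1) :
    (fun p : ℕ × ℕ => cauchyTerm q p.1 p.2) =O[⊤] fun p => ‖q‖ ^ p.2 := by
  have hinv (n : ℕ × ℕ → ℕ) : (fun p => (qPoch q q (n p))⁻¹) =O[⊤] fun _ => (1 : ℝ) := by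
    simpa using isBigO_inv_qPoch hq (one_sub_mul_pow_ne_zero hq hq) (fun _ => 0) n
  have hpow : (fun p : ℕ × ℕ => q ^ (p.2 ^ 2 + p.1 * p.2)) =O[⊤] fun p => ‖q‖ ^ p.2 :=
    isBigO_pow_of_le hq fun p => (Nat.le_self_pow two_ne_zero _).trans (Nat.le_add_right _ _)
  simpa [cauchyTerm, div_eq_mul_inv, mul_comm] using
    hpow.mul ((hinv fun p => p.2).mul (hinv fun p => p.1 + p.2))

theorem summable_cauchyTerm (hq : ‖q‖ < 1) (N : ℕ) : Summable (cauchyTerm q N) :=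
  summable_of_isBigO_norm_pow hq
    ((isBigO_cauchyTerm hq).comp_tendsto (l' := ⊤) (k := fun m : ℕ => (N, m)) tendsto_top)

theorem tsum_cauchyTerm_succ (hq : ‖q‖ < 1) (N : ℕ) :
    ∑' m, cauchyTerm q (N + 1) m = ∑' m, cauchyTerm q N m := by
  set v : ℕ → ℂ := fun m => cauchyTerm q N m * (1 - q ^ m) with hv
  have hterm (m : ℕ) : v (m + 1) = cauchyTerm q (N + 1) m - cauchyTerm q N m + v m := by
    have h3 := one_sub_mul_pow_ne_zero hq hq m
    have h4 := one_sub_mul_pow_ne_zero hq hq (N + m)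
    simp only [hv, cauchyTerm]
    rw [show N + 1 + m = N + m + 1 by ring, ← add_assoc N m, qPoch_succ _ _ m,
      qPoch_succ _ _ (N + m), pow_succ' q m]
    field_simp
    ring
  have hN := summable_cauchyTerm hq N
  have hvsum : Summable v := summable_of_isBigO_nat hN.norm <| by
    have hone := isBigO_one_of_tendsto (tendsto_one_sub_mul_pow 1 hq)
    simpa [hv] using ((isBigO_refl (cauchyTerm q N) ⊤).norm_right.mul hone).mono le_top
  have hshift := hvsum.tsum_eq_zero_add
  have hdiff := (summable_cauchyTerm hq (N + 1)).sub hN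
  simp_rw [hterm] at hshift
  rw [hdiff.tsum_add hvsum, (summable_cauchyTerm hq (N + 1)).tsum_sub hN,
    show v 0 = 0 by simp [hv]] at hshift
  linear_combination -hshift

theorem tendsto_cauchyTerm (hq : ‖q‖ < 1) (m : ℕ) :
    Tendsto (fun N => cauchyTerm q N m) atTop (𝓝 (if m = 0 then (qPochInf q q)⁻¹ else 0)) := by
  have hinv := ((tendsto_add_atTop_iff_nat m).2 (tendsto_qPoch q hq)).inv₀
    (qPochInf_ne_zero hq (one_sub_mul_pow_ne_zero hq hq))
  rcases m with _ | m
  · simpa [cauchyTerm, qPoch_zero] using hinv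
  · have hpow : Tendsto (fun N : ℕ => q ^ ((m + 1) ^ 2 + N * (m + 1))) atTop (𝓝 0) := by
      simp_rw [fun N : ℕ => show q ^ ((m + 1) ^ 2 + N * (m + 1)) =
        q ^ (m + 1) ^ 2 * (q ^ (m + 1)) ^ N by ring]
      refine tendsto_mul_pow_zero _ ?_
      rw [norm_pow]
      exact pow_lt_one₀ (norm_nonneg q) hq m.succ_ne_zero
    simpa [cauchyTerm, div_eq_mul_inv] using
      hpow.mul (hinv.mul_const (qPoch q q (m + 1))⁻¹)

theorem tsum_cauchyTerm (hq : ‖q‖ < 1) (N : ℕ) :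
    ∑' m, cauchyTerm q N m = (qPochInf q q)⁻¹ := by
  have hconst (N : ℕ) : ∑' m, cauchyTerm q N m = ∑' m, cauchyTerm q 0 m := by
    induction N with
    | zero => rfl
    | succ N ih => rw [tsum_cauchyTerm_succ hq, ih]
  obtain ⟨C, hC⟩ := isBigO_top.1 (isBigO_cauchyTerm hq)
  have hlim : Tendsto (fun N => ∑' m, cauchyTerm q N m) atTop
      (𝓝 (∑' m, if m = 0 then (qPochInf q q)⁻¹ else 0)) :=
    tendsto_tsum_of_dominated_convergence (bound := fun m => C * ‖q‖ ^ m)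
      ((summable_geometric_of_lt_one (norm_nonneg q) hq).mul_left C) (tendsto_cauchyTerm hq)
      (.of_forall fun N m => by simpa using hC (N, m))
  rw [tsum_ite_eq] at hlim
  simp_rw [hconst] at hlim
  rw [hconst, tendsto_nhds_unique tendsto_const_nhds hlim]

/-- Bailey pairs relative to `a = q`, normalised with `(q; q)_{n + r + 1}` in place of
`(a q; q)_{n + r}`. -/
def IsBaileyPair (q : ℂ) (α β : ℕ → ℂ) : Prop :=
  ∀ n, β n = ∑ r ∈ Finset.range (n + 1), α r / (qPoch q q (n - r) * qPoch q q (n + r + 1))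

theorem summable_mul_cauchyTerm (hq : ‖q‖ < 1) (hα : α =O[⊤] fun _ => (1 : ℝ)) :
    Summable fun p : ℕ × ℕ =>
      q ^ (p.1 ^ 2 + p.1) * α p.1 * cauchyTerm q (2 * p.1 + 1) p.2 := by
  have hpow : (fun p : ℕ × ℕ => q ^ (p.1 ^ 2 + p.1)) =O[⊤] fun p => ‖q‖ ^ p.1 :=
    isBigO_pow_of_le hq fun p => Nat.le_add_left _ _
  have hαfst := hα.comp_tendsto (l' := ⊤) (k := Prod.fst (β := ℕ)) tendsto_top
  have hcauchy := (isBigO_cauchyTerm hq).comp_tendsto (l' := ⊤)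
    (k := fun p : ℕ × ℕ => (2 * p.1 + 1, p.2)) tendsto_top
  have hgeom := summable_geometric_of_lt_one (norm_nonneg q) hq
  refine summable_of_isBigO (hgeom.mul_of_nonneg hgeom (fun _ => by positivity)
    fun _ => by positivity) ?_
  simpa using ((hpow.mul hαfst).mul hcauchy).mono le_top

theorem IsBaileyPair.hasSum (h : IsBaileyPair q α β) (hq : ‖q‖ < 1)
    (hα : α =O[⊤] fun _ => (1 : ℝ)) :
    HasSum (fun n => q ^ (n ^ 2 + n) * β n)
      ((∑' r, q ^ (r ^ 2 + r) * α r) / qPochInf q q) := by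
  set f : ℕ × ℕ → ℂ := fun p => q ^ (p.1 ^ 2 + p.1) * α p.1 * cauchyTerm q (2 * p.1 + 1) p.2
    with hf
  have hsum : Summable f := summable_mul_cauchyTerm hq hα
  have htotal : ∑' p, f p = (∑' r, q ^ (r ^ 2 + r) * α r) / qPochInf q q := by
    rw [hsum.tsum_prod, div_eq_mul_inv, ← tsum_mul_right]
    exact tsum_congr fun r => by simp only [hf, tsum_mul_left, tsum_cauchyTerm hq]
  have hdiagonal (n : ℕ) :
      ∑ p ∈ Finset.HasAntidiagonal.antidiagonal n, f p = q ^ (n ^ 2 + n) * β n := by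
    rw [Finset.Nat.sum_antidiagonal_eq_sum_range_succ_mk, h n, Finset.mul_sum]
    refine Finset.sum_congr rfl fun r hr => ?_
    obtain ⟨d, rfl⟩ := Nat.exists_eq_add_of_le (Nat.lt_succ_iff.1 (Finset.mem_range.1 hr))
    simp only [hf, cauchyTerm]
    rw [Nat.add_sub_cancel_left, show 2 * r + 1 + d = r + d + r + 1 by ring,
      show (r + d) ^ 2 + (r + d) = (r ^ 2 + r) + (d ^ 2 + (2 * r + 1) * d) by ring, pow_add]
    ring
  rw [← htotal]
  have hsigma :=
    (Finset.HasAntidiagonal.sigmaAntidiagonalEquivProd.hasSum_iff (f := f)).2 hsum.hasSum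
  simpa only [hdiagonal] using
    hsigma.sigma fun n => Finset.hasSum (Finset.HasAntidiagonal.antidiagonal n) f

/-- The first member of a Bailey pair in base `q = s ^ 2`; the second one is
`1 / (s; q)_{n + 1} ^ 2`. -/
noncomputable def baileyAlpha (s : ℂ) (r : ℕ) : ℂ :=
  (-1) ^ r * s ^ (r * (r + 1)) * ((1 + s * (s ^ 2) ^ r) / (1 - s * (s ^ 2) ^ r))

theorem isBigO_baileyAlpha (hs : ‖s‖ < 1) : baileyAlpha s =O[⊤] fun _ => (1 : ℝ) := by
  have hq := norm_sq_lt_one hs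
  have hsign : (fun r : ℕ => (-1) ^ r * s ^ (r * (r + 1))) =O[⊤] fun _ => (1 : ℝ) :=
    .of_norm_le fun r => by simpa using pow_le_one₀ (norm_nonneg s) hs.le
  have hnum := tendsto_one_sub_mul_pow (-s) hq
  simp only [neg_mul, sub_neg_eq_add] at hnum
  have hquot := isBigO_one_of_tendsto (hnum.div (tendsto_one_sub_mul_pow s hq) one_ne_zero)
  simpa [baileyAlpha] using hsign.mul hquot

/-- The summand left over when `1 / (s; q)_{n + 1} ^ 2` is compared with its predecessor, for
`N = n + 1`. -/
noncomputable def baileyDefect (s : ℂ) (N r : ℕ) : ℂ :=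
  (-1) ^ r * s ^ (r * (r + 1)) * (s ^ 2) ^ (N - r) * (1 - (s ^ 2) ^ (2 * r + 1)) /
    (qPoch (s ^ 2) (s ^ 2) (N - r) * qPoch (s ^ 2) (s ^ 2) (N + r + 1))

theorem one_sub_mul_sum_baileyDefect (hs : ‖s‖ < 1) (d R : ℕ) :
    (1 - (s ^ 2) ^ (R + d)) * ∑ r ∈ Finset.range R, baileyDefect s (R + d) r =
      -((-1) ^ R * s ^ (R * (R + 1)) * (s ^ 2) ^ d * (1 - (s ^ 2) ^ R) /
        (qPoch (s ^ 2) (s ^ 2) d * qPoch (s ^ 2) (s ^ 2) (R + d + R))) := by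
  have hq := norm_sq_lt_one hs
  induction R generalizing d with
  | zero => simp
  | succ R ih =>
    have h := ih (d + 1)
    have h3 := one_sub_mul_pow_ne_zero hq hq d
    have h4 := one_sub_mul_pow_ne_zero hq hq (R + d + 1 + R)
    rw [← add_assoc, add_right_comm R d 1] at h
    rw [Finset.sum_range_succ, mul_add, h, baileyDefect, show R + 1 + d - R = d + 1 by lia,
      show R + 1 + d + R = R + d + 1 + R by ring,
      show R + 1 + d + (R + 1) = R + d + 1 + R + 1 by ring, qPoch_succ _ _ d,
      qPoch_succ _ _ (R + d + 1 + R)]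
    field_simp
    ring

theorem sum_baileyDefect (hs : ‖s‖ < 1) (n : ℕ) :
    ∑ r ∈ Finset.range (n + 2), baileyDefect s (n + 1) r = 0 := by
  have hq := norm_sq_lt_one hs
  have hne : 1 - (s ^ 2) ^ (n + 1) ≠ 0 := by
    simpa [pow_succ'] using one_sub_mul_pow_ne_zero hq hq n
  have h4 := one_sub_mul_pow_ne_zero hq hq (n + 1 + (n + 1))
  have h := one_sub_mul_sum_baileyDefect hs 0 (n + 1)
  rw [add_zero] at h
  refine (mul_eq_zero.1 ?_).resolve_left hne
  rw [Finset.sum_range_succ, mul_add, h, baileyDefect, Nat.sub_self,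
    qPoch_succ _ _ (n + 1 + (n + 1)), qPoch_zero]
  field_simp
  ring

theorem baileyAlpha_sub_eq_baileyDefect (hs : ‖s‖ < 1) (r d : ℕ) :
    (1 - s * (s ^ 2) ^ (r + d)) ^ 2 * (baileyAlpha s r /
        (qPoch (s ^ 2) (s ^ 2) d * qPoch (s ^ 2) (s ^ 2) (r + d + r + 1))) -
      baileyAlpha s r * ((1 - (s ^ 2) ^ d) * (1 - (s ^ 2) ^ (r + d + r + 1))) /
        (qPoch (s ^ 2) (s ^ 2) d * qPoch (s ^ 2) (s ^ 2) (r + d + r + 1)) =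
    baileyDefect s (r + d) r := by
  have hne := one_sub_mul_pow_ne_zero hs (norm_sq_lt_one hs) r
  rw [baileyDefect, baileyAlpha, Nat.add_sub_cancel_left, ← mul_div_assoc, ← sub_div]
  congr 1
  field_simp
  ring

theorem sum_baileyAlpha_mul (hs : ‖s‖ < 1) (n : ℕ) :
    ∑ r ∈ Finset.range (n + 2), baileyAlpha s r *
        ((1 - (s ^ 2) ^ (n + 1 - r)) * (1 - (s ^ 2) ^ (n + 1 + r + 1))) /
        (qPoch (s ^ 2) (s ^ 2) (n + 1 - r) * qPoch (s ^ 2) (s ^ 2) (n + 1 + r + 1)) =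
      ∑ r ∈ Finset.range (n + 1), baileyAlpha s r /
        (qPoch (s ^ 2) (s ^ 2) (n - r) * qPoch (s ^ 2) (s ^ 2) (n + r + 1)) := by
  have hq := norm_sq_lt_one hs
  rw [Finset.sum_range_succ]
  simp only [Nat.sub_self, pow_zero, sub_self, zero_mul, mul_zero, zero_div, add_zero]
  refine Finset.sum_congr rfl fun r hr => ?_
  obtain ⟨d, rfl⟩ := Nat.exists_eq_add_of_le (Nat.lt_succ_iff.1 (Finset.mem_range.1 hr))
  have h3 := one_sub_mul_pow_ne_zero hq hq d
  have h4 := one_sub_mul_pow_ne_zero hq hq (r + d + r + 1)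
  rw [Nat.add_sub_cancel_left, show r + d + 1 - r = d + 1 by lia,
    show r + d + 1 + r + 1 = r + d + r + 1 + 1 by ring, qPoch_succ _ _ d,
    qPoch_succ _ _ (r + d + r + 1), pow_succ' _ d, pow_succ' _ (r + d + r + 1)]
  generalize 1 - s ^ 2 * (s ^ 2) ^ d = A at *
  generalize 1 - s ^ 2 * (s ^ 2) ^ (r + d + r + 1) = B at *
  field_simp

theorem isBaileyPair_baileyAlpha (hs : ‖s‖ < 1) :
    IsBaileyPair (s ^ 2) (baileyAlpha s) fun n => 1 / qPoch s (s ^ 2) (n + 1) ^ 2 := by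
  have hne := one_sub_mul_pow_ne_zero hs (norm_sq_lt_one hs)
  intro n
  beta_reduce
  induction n with
  | zero =>
    have h1 : 1 - s ≠ 0 := one_sub_ne_zero_of_norm_lt_one hs
    have h2 : 1 + s ≠ 0 := by
      simpa using one_sub_ne_zero_of_norm_lt_one (z := -s) (by simpa using hs)
    simp only [baileyAlpha, qPoch, Finset.sum_range_one, Finset.prod_range_one,
      Nat.sub_self, Finset.prod_range_zero, pow_zero, zero_add, mul_one, one_mul]
    rw [show 1 - s ^ 2 = (1 - s) * (1 + s) by ring]
    field_simp
  | succ n ih =>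
    have hrec : (1 - s * (s ^ 2) ^ (n + 1)) ^ 2 * ∑ r ∈ Finset.range (n + 2), baileyAlpha s r /
        (qPoch (s ^ 2) (s ^ 2) (n + 1 - r) * qPoch (s ^ 2) (s ^ 2) (n + 1 + r + 1)) =
        1 / qPoch s (s ^ 2) (n + 1) ^ 2 := by
      rw [ih, ← sum_baileyAlpha_mul hs n, ← sub_eq_zero, ← sum_baileyDefect hs n, Finset.mul_sum,
        ← Finset.sum_sub_distrib]
      refine Finset.sum_congr rfl fun r hr => ?_
      obtain ⟨d, hd⟩ := Nat.exists_eq_add_of_le (Nat.lt_succ_iff.1 (Finset.mem_range.1 hr))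
      rw [hd, Nat.add_sub_cancel_left, baileyAlpha_sub_eq_baileyDefect hs]
    have h2 := hne (n + 1)
    rw [qPoch_succ _ _ (n + 1), mul_pow, one_div, mul_inv, ← one_div, ← hrec]
    field_simp

theorem altTerm_eq_baileyAlpha (s : ℂ) (r : ℕ) :
    altTerm s r = (1 - s) / (1 + s) * ((s ^ 2) ^ (r ^ 2 + r) * baileyAlpha s r) := by
  rw [altTerm, baileyAlpha, show s * (s ^ 2) ^ r = s ^ (1 + 2 * r) by ring,
    show s ^ (3 * r * (r + 1)) = s ^ (r * (r + 1)) * (s ^ 2) ^ (r ^ 2 + r) by ring]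
  ring

theorem summable_altTerm (hs : ‖s‖ < 1) : Summable (altTerm s) := by
  have hq := norm_sq_lt_one hs
  have hO := (isBigO_pow_of_le hq fun r : ℕ => Nat.le_add_left r (r ^ 2)).mul
    (isBigO_baileyAlpha hs)
  simp only [mul_one] at hO
  exact ((summable_of_isBigO_norm_pow hq hO).mul_left _).congr fun r =>
    (altTerm_eq_baileyAlpha s r).symm

theorem tsum_pow_div_qPoch (hs : ‖s‖ < 1) :
    ∑' k, s ^ k / qPoch s (s ^ 2) (k + 1) =
      (1 + s) / ((1 - s) * qPochInf (s ^ 2) (s ^ 2)) * ∑' r, altTerm s r := by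
  have hq := norm_sq_lt_one hs
  have h1 : 1 - s ≠ 0 := one_sub_ne_zero_of_norm_lt_one hs
  have h2 : 1 + s ≠ 0 := by
    simpa using one_sub_ne_zero_of_norm_lt_one (z := -s) (by simpa using hs)
  have hfine := hasSum_rogersFine hq hs (one_sub_mul_pow_ne_zero hs hq)
  have hterm (n : ℕ) : (s * s) ^ n * (s ^ 2) ^ n ^ 2 /
      (qPoch s (s ^ 2) (n + 1) * qPoch s (s ^ 2) (n + 1)) =
      (s ^ 2) ^ (n ^ 2 + n) * (1 / qPoch s (s ^ 2) (n + 1) ^ 2) := by ring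
  simp_rw [hterm] at hfine
  rw [hfine.unique ((isBaileyPair_baileyAlpha hs).hasSum hq (isBigO_baileyAlpha hs))]
  simp_rw [altTerm_eq_baileyAlpha, tsum_mul_left]
  field_simp

end Bailey

/-! ### The `q`-gamma function -/

section QGamma

variable {q : ℝ} {a z : ℂ}

theorem norm_ofReal_lt_one (h0 : 0 < q) (h1 : q < 1) : ‖(q : ℂ)‖ < 1 := by
  rwa [Complex.norm_real, Real.norm_of_nonneg h0.le]

theorem one_sub_ofReal_ne_zero (h1 : q < 1) : 1 - (q : ℂ) ≠ 0 :=
  sub_ne_zero.2 (by exact_mod_cast h1.ne')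

theorem cpow_half_sq (w : ℂ) : (w ^ (1 / 2 : ℂ)) ^ 2 = w := by
  rw [← Complex.cpow_nat_mul]
  norm_num

theorem cpow_natCast_div_two (w : ℂ) (k : ℕ) : w ^ ((k : ℂ) / 2) = (w ^ (1 / 2 : ℂ)) ^ k := by
  rw [← Complex.cpow_nat_mul]
  ring_nf

theorem cpow_two_mul (w z : ℂ) : w ^ (2 * z) = (w ^ z) ^ 2 :=
  mod_cast Complex.cpow_nat_mul w 2 z

theorem cpow_three_mul (w z : ℂ) : w ^ (3 * z) = (w ^ z) ^ 3 :=
  mod_cast Complex.cpow_nat_mul w 3 z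

theorem norm_cpow_lt_one (h0 : 0 < q) (h1 : q < 1) (hz : 0 < z.re) : ‖(q : ℂ) ^ z‖ < 1 := by
  rw [Complex.norm_cpow_eq_rpow_re_of_pos h0]
  exact Real.rpow_lt_one h0.le h1 hz

theorem norm_cpow_half_lt_one (h0 : 0 < q) (h1 : q < 1) : ‖(q : ℂ) ^ (1 / 2 : ℂ)‖ < 1 :=
  norm_cpow_lt_one h0 h1 (by norm_num)

theorem cpow_add_natCast (h0 : 0 < q) (z : ℂ) (n : ℕ) :
    (q : ℂ) ^ (z + n) = (q : ℂ) ^ z * (q : ℂ) ^ n := by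
  rw [Complex.cpow_add _ _ (by exact_mod_cast h0.ne'), Complex.cpow_natCast]

theorem qGamma_ne_zero (h0 : 0 < q) (h1 : q < 1) (hz : ∀ i : ℕ, 1 - (q : ℂ) ^ (z + i) ≠ 0) :
    qGamma q z ≠ 0 := by
  have hq := norm_ofReal_lt_one h0 h1
  simp only [cpow_add_natCast h0] at hz
  refine div_ne_zero (mul_ne_zero ?_ (qPochInf_ne_zero hq (one_sub_mul_pow_ne_zero hq hq)))
    (qPochInf_ne_zero hq hz)
  exact fun h => one_sub_ofReal_ne_zero h1 ((Complex.cpow_eq_zero_iff _ _).1 h).1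

theorem qGamma_ne_zero_of_re_pos (h0 : 0 < q) (h1 : q < 1) (hz : 0 < z.re) :
    qGamma q z ≠ 0 :=
  qGamma_ne_zero h0 h1 fun i =>
    one_sub_ne_zero_of_norm_lt_one <| norm_cpow_lt_one h0 h1 <| by
      rw [Complex.add_re, Complex.natCast_re]
      positivity

theorem qGamma_add_nat (h0 : 0 < q) (h1 : q < 1) (n : ℕ) (hz : qPoch ((q : ℂ) ^ z) q n ≠ 0) :
    qGamma q (z + n) = qGamma q z * qPoch ((q : ℂ) ^ z) q n / (1 - (q : ℂ)) ^ n := by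
  have hD := one_sub_ofReal_ne_zero h1
  rw [qGamma, qGamma, qPochInf_eq_mul ((q : ℂ) ^ z) (norm_ofReal_lt_one h0 h1) n,
    cpow_add_natCast h0, ← sub_sub, Complex.cpow_sub (1 - z) _ hD, Complex.cpow_natCast]
  field_simp

theorem qGamma_add_one (h0 : 0 < q) (h1 : q < 1) (hz : 1 - (q : ℂ) ^ z ≠ 0) :
    qGamma q (z + 1) = qGamma q z * (1 - (q : ℂ) ^ z) / (1 - (q : ℂ)) := by
  simpa [qPoch] using qGamma_add_nat h0 h1 1 (z := z) (by simpa [qPoch] using hz)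

theorem qGamma_one (h0 : 0 < q) (h1 : q < 1) : qGamma q 1 = 1 := by
  have hq := norm_ofReal_lt_one h0 h1
  simp [qGamma, qPochInf_ne_zero hq (one_sub_mul_pow_ne_zero hq hq)]

theorem WZParam.mul_ne {s x : ℂ} (h : WZParam s x) (i : ℕ) : 1 - x * s * (s ^ 2) ^ i ≠ 0 :=
  fun h0 => h.sq_ne (2 * i) <| by linear_combination (1 + x * s * (s ^ 2) ^ i) * h0

theorem qGamma_mul_wzConst (h0 : 0 < q) (h1 : q < 1)
    (h : WZParam ((q : ℂ) ^ (1 / 2 : ℂ)) ((q : ℂ) ^ a)) :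
    qGamma q (a + 1 / 2) ^ 6 * qGamma q (3 * a + 1) *
        wzConst ((q : ℂ) ^ (1 / 2 : ℂ)) ((q : ℂ) ^ a) =
      (1 - (q : ℂ)) ^ 3 * qPochInf q q * qGamma q (a + 1) ^ 3 * qGamma q (2 * a + 1) ^ 3 := by
  have hq : (q : ℂ) ≠ 0 := by exact_mod_cast h0.ne'
  have hD := one_sub_ofReal_ne_zero h1
  have hexp (n : ℕ) : (1 - (q : ℂ)) ^ (1 - (n * a + 1)) = ((1 - (q : ℂ)) ^ (-a)) ^ n := by
    rw [← Complex.cpow_nat_mul]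
    ring_nf
  have hhalf : (1 - (q : ℂ)) ^ (1 - (a + 1 / 2)) =
      (1 - (q : ℂ)) ^ (1 / 2 : ℂ) * (1 - (q : ℂ)) ^ (-a) := by
    rw [← Complex.cpow_add _ _ hD]
    ring_nf
  have hpow (n : ℕ) : (q : ℂ) ^ (n * a + 1) = ((q : ℂ) ^ a) ^ n * q := by
    rw [Complex.cpow_add _ _ hq, Complex.cpow_nat_mul, Complex.cpow_one]
  have hexp₁ := hexp 1
  have hexp₂ := hexp 2
  have hexp₃ := hexp 3
  have hpow₁ := hpow 1
  have hpow₂ := hpow 2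
  have hpow₃ := hpow 3
  push_cast [one_mul, pow_one] at hexp₁ hexp₂ hexp₃ hpow₁ hpow₂ hpow₃
  have hnorm := h.norm_sq_lt
  have n1 := qPochInf_ne_zero hnorm h.mul_ne
  have n2 := qPochInf_ne_zero hnorm h.mul_sq_ne
  have n3 := qPochInf_ne_zero hnorm h.sq_ne
  have n4 := qPochInf_ne_zero hnorm h.cube_ne
  rw [cpow_half_sq] at n1 n2 n3 n4
  simp only [qGamma, wzConst, hexp₁, hexp₂, hexp₃, hhalf, hpow₁, hpow₂, hpow₃, cpow_half_sq,
    Complex.cpow_add _ _ hq]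
  have hsq := cpow_half_sq (1 - (q : ℂ))
  generalize (1 - (q : ℂ)) ^ (1 / 2 : ℂ) = e at hsq ⊢
  generalize (1 - (q : ℂ)) ^ (-a) = c
  generalize qPochInf ((q : ℂ) ^ a * q) q = A at *
  generalize qPochInf (((q : ℂ) ^ a) ^ 2 * q) q = B at *
  generalize qPochInf (((q : ℂ) ^ a) ^ 3 * q) q = C at *
  field_simp
  rw [← hsq]
  ring

end QGamma

/-! ### The specialization `s = q ^ (1 / 2)`, `x = q ^ a` -/

/-- The parameters `q` and `a` for which neither `q ^ (2 * a)` nor `q ^ (3 * a)` is an integral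
power of `q`. -/
structure GenericParam (q : ℝ) (a : ℂ) : Prop where
  pos : 0 < q
  lt_one : q < 1
  cpow_ne : ∀ m : ℤ, (q : ℂ) ^ (2 * a) ≠ (q : ℂ) ^ m ∧ (q : ℂ) ^ (3 * a) ≠ (q : ℂ) ^ m

/-- The factor of `wzF q a k` that does not depend on `k`, see `GenericParam.wzF_eq`. -/
noncomputable def wzScale (q : ℝ) (a : ℂ) : ℂ := factorA q a / (1 - (q : ℂ) ^ a) ^ 3

theorem wzScale_eq (q : ℝ) (a : ℂ) :
    wzScale q a = (q : ℂ) ^ a * (qGamma q (1 - a) / qGamma q (1 / 2 - a)) ^ 2 *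
      qGamma q (a + 1 / 2) ^ 4 * qGamma q (3 * a + 1) /
      (qGamma q (1 / 2) ^ 2 * qGamma q (a + 1) * qGamma q (2 * a + 1) ^ 3 *
        (1 - (q : ℂ) ^ a) ^ 2) := by
  rw [wzScale, factorA, div_pow]
  field_simp

namespace GenericParam

variable {q : ℝ} {a z : ℂ}

theorem ofReal_ne_zero (h : GenericParam q a) : (q : ℂ) ≠ 0 := by exact_mod_cast h.pos.ne'

theorem cpow_ne_zero (h : GenericParam q a) (z : ℂ) : (q : ℂ) ^ z ≠ 0 := fun h0 =>
  h.ofReal_ne_zero ((Complex.cpow_eq_zero_iff _ _).1 h0).1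

theorem one_sub_cpow_ne_zero (h : GenericParam q a) (j m : ℤ)
    (hz : j * z = 2 * a + m ∨ j * z = 3 * a + m) : 1 - (q : ℂ) ^ z ≠ 0 := by
  intro h0
  have hpow : (q : ℂ) ^ (j * z) = 1 := by
    rw [Complex.cpow_int_mul, ← sub_eq_zero.1 h0, one_zpow]
  have hinv (w : ℂ) (hw : j * z = w + m) : (q : ℂ) ^ w = (q : ℂ) ^ (-m) := by
    rw [hw, Complex.cpow_add _ _ h.ofReal_ne_zero, Complex.cpow_intCast] at hpow
    rw [zpow_neg, eq_inv_of_mul_eq_one_left hpow]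
  exact hz.elim (fun hz => (h.cpow_ne (-m)).1 (hinv _ hz)) fun hz => (h.cpow_ne (-m)).2 (hinv _ hz)

theorem one_sub_cpow_add_nat_ne_zero (h : GenericParam q a) (j m : ℤ)
    (hz : j * z = 2 * a + m ∨ j * z = 3 * a + m) (i : ℕ) : 1 - (q : ℂ) ^ (z + i) ≠ 0 := by
  refine h.one_sub_cpow_ne_zero j (m + j * i) (hz.imp (fun hz => ?_) fun hz => ?_) <;>
  · push_cast
    linear_combination hz

theorem qGamma_ne_zero (h : GenericParam q a) (j m : ℤ)
    (hz : j * z = 2 * a + m ∨ j * z = 3 * a + m) : qGamma q z ≠ 0 :=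
  _root_.qGamma_ne_zero h.pos h.lt_one (h.one_sub_cpow_add_nat_ne_zero j m hz)

theorem qGamma_add_one (h : GenericParam q a) (j m : ℤ)
    (hz : j * z = 2 * a + m ∨ j * z = 3 * a + m) :
    qGamma q (z + 1) = qGamma q z * (1 - (q : ℂ) ^ z) / (1 - (q : ℂ)) :=
  _root_.qGamma_add_one h.pos h.lt_one (h.one_sub_cpow_ne_zero j m hz)

theorem qGamma_add_nat (h : GenericParam q a) (j m : ℤ)
    (hz : j * z = 2 * a + m ∨ j * z = 3 * a + m) (n : ℕ) :
    qGamma q (z + n) = qGamma q z * qPoch ((q : ℂ) ^ z) q n / (1 - (q : ℂ)) ^ n :=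
  _root_.qGamma_add_nat h.pos h.lt_one n <| qPoch_ne_zero
    (fun i => cpow_add_natCast h.pos z i ▸ h.one_sub_cpow_add_nat_ne_zero j m hz i) n

theorem add_one (h : GenericParam q a) : GenericParam q (a + 1) := by
  refine ⟨h.pos, h.lt_one, fun m => ⟨fun h0 => ?_, fun h0 => ?_⟩⟩
  · refine h.one_sub_cpow_ne_zero 1 (2 - m) (z := 2 * (a + 1) - m) (.inl (by push_cast; ring)) ?_
    rw [Complex.cpow_sub _ _ h.ofReal_ne_zero, h0, Complex.cpow_intCast,
      div_self (zpow_ne_zero _ h.ofReal_ne_zero), sub_self]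
  · refine h.one_sub_cpow_ne_zero 1 (3 - m) (z := 3 * (a + 1) - m) (.inr (by push_cast; ring)) ?_
    rw [Complex.cpow_sub _ _ h.ofReal_ne_zero, h0, Complex.cpow_intCast,
      div_self (zpow_ne_zero _ h.ofReal_ne_zero), sub_self]

theorem add_nat (h : GenericParam q a) (n : ℕ) : GenericParam q (n + a) := by
  induction n with
  | zero => simpa using h
  | succ n ih => simpa only [Nat.cast_succ, add_right_comm] using ih.add_one

theorem one_sub_cpow_self_ne_zero (h : GenericParam q a) : 1 - (q : ℂ) ^ a ≠ 0 :=
  h.one_sub_cpow_ne_zero 2 0 (.inl (by push_cast; ring))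

theorem one_sub_cpow_three_mul_add_nat_ne_zero (h : GenericParam q a) (i : ℕ) :
    1 - ((q : ℂ) ^ a) ^ 3 * (q : ℂ) ^ i ≠ 0 := by
  have := h.one_sub_cpow_add_nat_ne_zero 1 0 (z := 3 * a) (.inr (by push_cast; ring)) i
  rwa [cpow_add_natCast h.pos, cpow_three_mul] at this

theorem wzParam (h : GenericParam q a) : WZParam ((q : ℂ) ^ (1 / 2 : ℂ)) ((q : ℂ) ^ a) where
  norm_lt := norm_cpow_half_lt_one h.pos h.lt_one
  sq_ne i := by
    have := h.one_sub_cpow_add_nat_ne_zero 1 0 (z := 2 * a) (.inl (by push_cast; ring)) (i + 1)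
    rwa [cpow_half_sq, mul_assoc, ← pow_succ', ← cpow_two_mul, ← cpow_add_natCast h.pos]
  cube_ne i := by
    have := h.one_sub_cpow_three_mul_add_nat_ne_zero (i + 1)
    rwa [cpow_half_sq, mul_assoc, ← pow_succ']
  quad_ne h0 := by
    have := h.one_sub_cpow_three_mul_add_nat_ne_zero 0
    exact this (by linear_combination (1 - (q : ℂ) ^ a) * h0)

theorem factorA_ne_zero (h : GenericParam q a) : factorA q a ≠ 0 := by
  have h0 := h.cpow_ne_zero a
  have h1 := h.one_sub_cpow_self_ne_zero
  have g1 := h.qGamma_ne_zero (-2) (-2) (z := 1 - a) (.inl (by push_cast; ring))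
  have g2 := h.qGamma_ne_zero 2 1 (z := a + 1 / 2) (.inl (by push_cast; ring))
  have g3 := h.qGamma_ne_zero 1 1 (z := 3 * a + 1) (.inr (by push_cast; ring))
  have g4 := qGamma_ne_zero_of_re_pos h.pos h.lt_one (z := 1 / 2) (by norm_num)
  have g5 := h.qGamma_ne_zero (-2) (-1) (z := 1 / 2 - a) (.inl (by push_cast; ring))
  have g6 := h.qGamma_ne_zero 2 2 (z := a + 1) (.inl (by push_cast; ring))
  have g7 := h.qGamma_ne_zero 1 1 (z := 2 * a + 1) (.inl (by push_cast; ring))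
  unfold factorA
  positivity

theorem kTerm_eq (h : GenericParam q a) (k : ℕ) :
    kTerm q a k = wzKernel ((q : ℂ) ^ (1 / 2 : ℂ)) ((q : ℂ) ^ a) k / (1 - (q : ℂ) ^ a) ^ 3 := by
  have hx := h.one_sub_cpow_self_ne_zero
  have hcube := h.one_sub_cpow_three_mul_add_nat_ne_zero
  have hquad := h.wzParam.quad_ne
  have hshift : qPoch (((q : ℂ) ^ a) ^ 3) q k = (1 - ((q : ℂ) ^ a) ^ 3) *
      qPoch (((q : ℂ) ^ a) ^ 3 * q) q k / (1 - ((q : ℂ) ^ a) ^ 3 * q ^ k) := by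
    rw [eq_div_iff (hcube k), ← qPoch_succ, qPoch_succ']
  have hdouble : (q : ℂ) ^ (2 * k : ℂ) = q ^ (2 * k) := by
    exact_mod_cast Complex.cpow_natCast (q : ℂ) (2 * k)
  rw [kTerm, wzKernel, cpow_natCast_div_two, cpow_half_sq, hshift, qPoch_succ _ _ k]
  simp only [Complex.cpow_add _ _ h.ofReal_ne_zero, cpow_three_mul, cpow_two_mul, hdouble,
    Complex.cpow_one, Complex.cpow_natCast]
  rw [show 1 - ((q : ℂ) ^ a) ^ 3 = (1 - (q : ℂ) ^ a) * (1 + (q : ℂ) ^ a + ((q : ℂ) ^ a) ^ 2) by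
    ring]
  generalize (q : ℂ) ^ a = x at *
  generalize (q : ℂ) ^ (1 / 2 : ℂ) = s at *
  generalize 1 - x ^ 3 * (q : ℂ) ^ k = A at *
  generalize 1 + x + x ^ 2 = B at *
  generalize 1 - x = X at *
  field_simp

theorem nTerm_eq (h : GenericParam q a) (n : ℕ) :
    nTerm q a n = wzWeight ((q : ℂ) ^ (1 / 2 : ℂ)) ((q : ℂ) ^ a) n *
      wzMateZero ((q : ℂ) ^ (1 / 2 : ℂ)) ((q : ℂ) ^ a * q ^ n) / (1 - (q : ℂ) ^ a) ^ 3 := by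
  have hdouble : (q : ℂ) ^ (2 * n : ℂ) = q ^ (2 * n) := by
    exact_mod_cast Complex.cpow_natCast (q : ℂ) (2 * n)
  rw [nTerm, wzWeight, wzMateZero, cpow_half_sq]
  simp only [Complex.cpow_add _ _ h.ofReal_ne_zero, cpow_three_mul, cpow_two_mul, hdouble,
    Complex.cpow_one, Complex.cpow_natCast]
  rw [div_mul_div_comm, div_div]
  congr 1 <;> ring

end GenericParam

theorem wzF_eq_qGamma (q : ℝ) (a : ℂ) (k : ℕ) :
    wzF q a k = (q : ℂ) ^ ((k : ℂ) / 2 + a) * (1 - (q : ℂ) ^ (1 / 2 + 3 * a + (2 * k : ℕ))) *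
        qGamma q (a + 1 / 2 + k) ^ 3 * qGamma q (3 * a + k) * qGamma q (a + 1 / 2) *
        qGamma q (1 - a) ^ 2 /
      ((1 - (q : ℂ)) * qGamma q (1 / 2 - a) ^ 2 * qGamma q a * qGamma q (2 * a + 1 + k) ^ 3 *
        qGamma q (1 / 2 + (k + 1 : ℕ)) * qGamma q (1 / 2)) := by
  rw [wzF, dougall5F4q]
  push_cast
  ring_nf

namespace GenericParam

theorem wzF_eq (h : GenericParam q a) (k : ℕ) :
    wzF q a k = wzScale q a * wzKernel ((q : ℂ) ^ (1 / 2 : ℂ)) ((q : ℂ) ^ a) k := by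
  have hq := h.ofReal_ne_zero
  have hD := one_sub_ofReal_ne_zero h.lt_one
  have hx := h.one_sub_cpow_self_ne_zero
  have hquad := h.wzParam.quad_ne
  have hhalf := h.wzParam.qPoch_s_ne (k + 1)
  have hsq := qPoch_ne_zero h.wzParam.sq_ne k
  have g1 := h.qGamma_ne_zero 2 0 (z := a) (.inl (by push_cast; ring))
  have g2 := h.qGamma_ne_zero 1 1 (z := 2 * a + 1) (.inl (by push_cast; ring))
  have g3 := h.qGamma_ne_zero (-2) (-1) (z := 1 / 2 - a) (.inl (by push_cast; ring))
  have g4 := qGamma_ne_zero_of_re_pos h.pos h.lt_one (z := 1 / 2) (by norm_num)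
  rw [cpow_half_sq] at hhalf hsq
  rw [wzF_eq_qGamma, h.qGamma_add_nat 2 1 (z := a + 1 / 2) (.inl (by push_cast; ring)),
    h.qGamma_add_nat 1 1 (z := 2 * a + 1) (.inl (by push_cast; ring)),
    h.qGamma_add_nat 1 0 (z := 3 * a) (.inr (by push_cast; ring)),
    _root_.qGamma_add_nat h.pos h.lt_one (k + 1) hhalf, wzScale, factorA, wzKernel,
    h.qGamma_add_one 1 0 (z := 3 * a) (.inr (by push_cast; ring)),
    h.qGamma_add_one 2 0 (z := a) (.inl (by push_cast; ring)), cpow_half_sq]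
  simp only [Complex.cpow_add _ _ hq, cpow_three_mul, cpow_two_mul, cpow_natCast_div_two,
    Complex.cpow_one, Complex.cpow_natCast]
  rw [show 1 - ((q : ℂ) ^ a) ^ 3 = (1 - (q : ℂ) ^ a) * (1 + (q : ℂ) ^ a + ((q : ℂ) ^ a) ^ 2) by
    ring]
  generalize (q : ℂ) ^ a = x at *
  generalize 1 + x + x ^ 2 = B at *
  generalize 1 - x = X at *
  generalize 1 - (q : ℂ) = D at *
  generalize qPoch (x ^ 2 * q) q k = P at *
  generalize qPoch _ _ (k + 1) = P' at *
  generalize qGamma q a = G₁ at *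
  generalize qGamma q (2 * a + 1) = G₂ at *
  generalize qGamma q (1 / 2 - a) = G₃ at *
  generalize qGamma q (1 / 2) = G₄ at *
  generalize qGamma q (a + 1 / 2) = G₅ at *
  generalize qGamma q (3 * a) = G₆ at *
  field_simp
  ring

theorem qGamma_div_qGamma_add_one (h : GenericParam q a) :
    qGamma q (1 - (a + 1)) / qGamma q (1 / 2 - (a + 1)) =
      qGamma q (1 - a) / qGamma q (1 / 2 - a) *
        ((1 - (q : ℂ) ^ (a + 1 / 2)) / ((q : ℂ) ^ (1 / 2 : ℂ) * (1 - (q : ℂ) ^ a))) := by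
  have hq := h.ofReal_ne_zero
  have hD := one_sub_ofReal_ne_zero h.lt_one
  have hx := h.one_sub_cpow_self_ne_zero
  have hhalf := h.one_sub_cpow_ne_zero 2 1 (z := a + 1 / 2) (.inl (by push_cast; ring))
  have hx0 := h.cpow_ne_zero a
  have hs0 := h.cpow_ne_zero (1 / 2)
  have hinv (w : ℂ) (hw : w ≠ 0) : 1 - w⁻¹ = -(1 - w) / w := by
    field_simp
    ring
  rw [show 1 - (a + 1) = -a by ring, show 1 / 2 - (a + 1) = -(a + 1 / 2) by ring,
    show 1 - a = -a + 1 by ring, show 1 / 2 - a = -(a + 1 / 2) + 1 by ring,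
    h.qGamma_add_one (-2) 0 (z := -a) (.inl (by push_cast; ring)),
    h.qGamma_add_one (-2) 1 (z := -(a + 1 / 2)) (.inl (by push_cast; ring)),
    Complex.cpow_neg, Complex.cpow_neg, Complex.cpow_add _ _ hq, hinv _ hx0,
    hinv _ (mul_ne_zero hx0 hs0)]
  rw [Complex.cpow_add _ _ hq] at hhalf
  generalize qGamma q (-a) = G₁ at *
  generalize qGamma q (-(a + 1 / 2)) = G₂ at *
  generalize 1 - (q : ℂ) ^ a * (q : ℂ) ^ (1 / 2 : ℂ) = X at *
  field_simp

theorem wzScale_add_one (h : GenericParam q a) :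
    wzScale q (a + 1) = wzRatio ((q : ℂ) ^ (1 / 2 : ℂ)) ((q : ℂ) ^ a) * wzScale q a := by
  have hq := h.ofReal_ne_zero
  have hD := one_sub_ofReal_ne_zero h.lt_one
  have hx := h.one_sub_cpow_self_ne_zero
  rw [wzScale_eq q (a + 1), h.qGamma_div_qGamma_add_one, wzScale_eq q a,
    show a + 1 + 1 / 2 = a + 1 / 2 + 1 by ring,
    h.qGamma_add_one 2 1 (z := a + 1 / 2) (.inl (by push_cast; ring)),
    h.qGamma_add_one 2 2 (z := a + 1) (.inl (by push_cast; ring)),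
    show 3 * (a + 1) + 1 = 3 * a + 1 + (3 : ℕ) by push_cast; ring,
    h.qGamma_add_nat 1 1 (z := 3 * a + 1) (.inr (by push_cast; ring)),
    show 2 * (a + 1) + 1 = 2 * a + 1 + (2 : ℕ) by push_cast; ring,
    h.qGamma_add_nat 1 1 (z := 2 * a + 1) (.inl (by push_cast; ring)), wzRatio, cpow_half_sq]
  simp only [Complex.cpow_add _ _ hq, cpow_three_mul, cpow_two_mul, Complex.cpow_one]
  simp only [div_pow, mul_pow, cpow_half_sq]
  have hxq : 1 - (q : ℂ) ^ a * q ≠ 0 := by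
    simpa [cpow_half_sq] using h.wzParam.mul_sq_ne 0
  have g1 := h.qGamma_ne_zero 2 2 (z := a + 1) (.inl (by push_cast; ring))
  have g2 := h.qGamma_ne_zero 1 1 (z := 2 * a + 1) (.inl (by push_cast; ring))
  have g3 := h.qGamma_ne_zero (-2) (-1) (z := 1 / 2 - a) (.inl (by push_cast; ring))
  have g4 := qGamma_ne_zero_of_re_pos h.pos h.lt_one (z := 1 / 2) (by norm_num)
  have hsq := qPoch_ne_zero h.wzParam.sq_ne 2
  rw [cpow_half_sq] at hsq
  generalize (q : ℂ) ^ a = x at *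
  generalize qGamma q (a + 1) = G₁ at *
  generalize qGamma q (2 * a + 1) = G₂ at *
  generalize qGamma q (1 / 2 - a) = G₃ at *
  generalize qGamma q (1 / 2) = G₄ at *
  generalize qGamma q (a + 1 / 2) = G₅ at *
  generalize qPoch _ _ 2 = P at *
  generalize 1 - (q : ℂ) = D at *
  generalize 1 - x = X at *
  generalize 1 - x * q = Y at *
  field_simp

theorem wzF_natCast_add (h : GenericParam q a) (n k : ℕ) :
    wzF q (n + a) k = wzScale q a * (wzWeight ((q : ℂ) ^ (1 / 2 : ℂ)) ((q : ℂ) ^ a) n *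
      wzKernel ((q : ℂ) ^ (1 / 2 : ℂ)) ((q : ℂ) ^ a * q ^ n) k) := by
  have hscale : wzScale q (n + a) =
      wzScale q a * wzWeight ((q : ℂ) ^ (1 / 2 : ℂ)) ((q : ℂ) ^ a) n := by
    induction n with
    | zero => simp [wzWeight, qPoch]
    | succ n ih =>
      rw [Nat.cast_succ, add_right_comm, (h.add_nat n).wzScale_add_one, ih, wzWeight_succ,
        cpow_half_sq, add_comm, cpow_add_natCast h.pos]
      ring
  rw [(h.add_nat n).wzF_eq, hscale, add_comm, cpow_add_natCast h.pos, mul_assoc]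

theorem wzScale_mul_wzConst_mul_tsum (h : GenericParam q a) :
    wzScale q a * (wzConst ((q : ℂ) ^ (1 / 2 : ℂ)) ((q : ℂ) ^ a) *
      ∑' k, ((q : ℂ) ^ (1 / 2 : ℂ)) ^ k /
        qPoch ((q : ℂ) ^ (1 / 2 : ℂ)) (((q : ℂ) ^ (1 / 2 : ℂ)) ^ 2) (k + 1)) =
      boundaryValue q a := by
  have hx := h.one_sub_cpow_self_ne_zero
  have hnorm := norm_cpow_half_lt_one h.pos h.lt_one
  have hs := one_sub_ne_zero_of_norm_lt_one hnorm
  have hnormq := norm_ofReal_lt_one h.pos h.lt_one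
  have hinf := qPochInf_ne_zero hnormq (one_sub_mul_pow_ne_zero hnormq hnormq)
  have g2 := h.qGamma_ne_zero 1 1 (z := 2 * a + 1) (.inl (by push_cast; ring))
  have g3 := h.qGamma_ne_zero 1 1 (z := 3 * a + 1) (.inr (by push_cast; ring))
  have g5 := h.qGamma_ne_zero 2 1 (z := a + 1 / 2) (.inl (by push_cast; ring))
  have hconst := qGamma_mul_wzConst h.pos h.lt_one h.wzParam
  rw [mul_comm, ← eq_div_iff (by positivity)] at hconst
  rw [hconst, tsum_pow_div_qPoch hnorm, boundaryValue, wzScale_eq q a, cpow_half_sq,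
    show (3 / 2 : ℂ) = 1 / 2 + 1 by norm_num, _root_.qGamma_add_one h.pos h.lt_one hs,
    h.qGamma_add_one 2 0 (z := a) (.inl (by push_cast; ring))]
  have hfactor : 1 - (q : ℂ) = (1 - (q : ℂ) ^ (1 / 2 : ℂ)) * (1 + (q : ℂ) ^ (1 / 2 : ℂ)) := by
    linear_combination cpow_half_sq (q : ℂ)
  generalize qGamma q a = G₁ at *
  generalize qGamma q (2 * a + 1) = G₂ at *
  generalize qGamma q (3 * a + 1) = G₃ at *
  generalize qGamma q (1 / 2) = G₄ at *
  generalize qGamma q (a + 1 / 2) = G₅ at *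
  generalize qGamma q (1 / 2 - a) = G₆ at *
  generalize (q : ℂ) ^ a = x at *
  generalize 1 - x = X at *
  generalize qPochInf _ _ = I at *
  generalize (q : ℂ) ^ (1 / 2 : ℂ) = s at *
  generalize (∑' _, _ : ℂ) = S at *
  generalize qGamma q (1 - a) = G₇ at *
  rw [hfactor]
  generalize 1 - s = D at *
  generalize 1 + s = E at *
  field_simp

end GenericParam

/-! ### The series identity at `a = 0` -/

theorem wzParam_one {s : ℂ} (hs : ‖s‖ < 1) : WZParam s 1 where
  norm_lt := hs
  sq_ne i := by
    simpa using one_sub_mul_pow_ne_zero (norm_sq_lt_one hs) (norm_sq_lt_one hs) i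
  cube_ne i := by
    simpa using one_sub_mul_pow_ne_zero (norm_sq_lt_one hs) (norm_sq_lt_one hs) i
  quad_ne := by norm_num

theorem wzWeight_one_mul_wzMateZero {s : ℂ} (hs : ‖s‖ < 1) (n : ℕ) :
    wzWeight s 1 n * wzMateZero s (1 * (s ^ 2) ^ n) = -qGuilleraTerm s n := by
  have hodd : 1 - s ^ (2 * n + 1) ≠ 0 := by
    have := one_sub_mul_pow_ne_zero hs (norm_sq_lt_one hs) n
    rwa [← pow_mul, ← pow_succ'] at this
  have hpoly : polyP (s ^ 2) s ((s ^ 2) ^ n) = -((1 - s ^ (2 * n + 1)) ^ 3 *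
      (3 * s ^ (2 * n + 1) - 4 * s ^ (4 * n + 1) + 2 * s ^ (4 * n + 2) - 4 * s ^ (6 * n + 1)
        - 4 * s ^ (6 * n + 2) + 2 * s ^ (8 * n + 1) - 4 * s ^ (8 * n + 2)
        + 3 * s ^ (10 * n + 2) + 3 * s ^ (12 * n + 3) + 3)) := by
    rw [polyP]
    ring
  rw [one_mul, wzWeight, wzMateZero, hpoly, qGuilleraTerm,
    show 1 - ((s ^ 2) ^ n) ^ 2 * s ^ 2 = (1 - s ^ (2 * n + 1)) * (s ^ (2 * n + 1) + 1) by ring,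
    show 1 + (s ^ 2) ^ n + ((s ^ 2) ^ n) ^ 2 = s ^ (2 * n) + s ^ (4 * n) + 1 by ring]
  simp only [one_pow, one_mul, ← pow_mul]
  generalize 1 - s ^ (2 * n + 1) = B at *
  generalize s ^ (2 * n + 1) + 1 = C at *
  generalize s ^ (2 * n) + s ^ (4 * n) + 1 = A at *
  field_simp

theorem sq_cpow_half {q : ℝ} (h0 : 0 < q) : ((q ^ 2 : ℝ) : ℂ) ^ (1 / 2 : ℂ) = q := by
  rw [Complex.ofReal_pow, one_div]
  exact Complex.sq_cpow_two_inv (by simpa using h0)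

theorem qGuilleraValue_eq {q : ℝ} (h0 : 0 < q) (h1 : q < 1) :
    qGuilleraValue q = wzConst (q : ℂ) 1 * ∑' k, (q : ℂ) ^ k / qPoch q ((q : ℂ) ^ 2) (k + 1) := by
  have hq := norm_ofReal_lt_one h0 h1
  have hq2 := norm_sq_lt_one hq
  have hinf := qPochInf_ne_zero hq2 (one_sub_mul_pow_ne_zero hq2 hq2)
  have hpos : 0 < q ^ 2 := by positivity
  have hlt : q ^ 2 < 1 := pow_lt_one₀ h0.le h1 two_ne_zero
  have hgamma := qGamma_ne_zero_of_re_pos hpos hlt (z := 1 / 2) (by norm_num)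
  have hconst := qGamma_mul_wzConst hpos hlt (a := 0)
    (by simpa only [sq_cpow_half h0, Complex.cpow_zero] using wzParam_one hq)
  rw [sq_cpow_half h0, Complex.cpow_zero] at hconst
  simp only [mul_zero, zero_add, qGamma_one hpos hlt, Complex.ofReal_pow, one_pow,
    mul_one] at hconst
  rw [mul_comm, ← eq_div_iff (by positivity)] at hconst
  rw [hconst, tsum_pow_div_qPoch hq, qGuilleraValue,
    show 1 - (q : ℂ) ^ 2 = (1 - q) * (1 + q) by ring]
  generalize 1 - (q : ℂ) = D at *
  field_simp

theorem hasSum_qGuilleraTerm {q : ℝ} (h0 : 0 < q) (h1 : q < 1) :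
    HasSum (fun n : ℕ => qGuilleraTerm q n) (qGuilleraValue q) := by
  have hq := norm_ofReal_lt_one h0 h1
  have hkernel (k : ℕ) : wzKernel (q : ℂ) 1 k = 0 := by simp [wzKernel]
  have h := (wzParam_one hq).hasSum_wzWeight_mul_wzMateZero.neg
  simp only [wzWeight_one_mul_wzMateZero hq, neg_neg, hkernel, tsum_zero, zero_sub] at h
  rwa [qGuilleraValue_eq h0 h1]

/-! ### The termwise limit -/

theorem tendsto_one_sub_pow_div (m : ℕ) :
    Tendsto (fun q : ℂ => (1 - q ^ m) / (1 - q)) (𝓝[≠] 1) (𝓝 m) := by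
  have h := (hasDerivAt_pow m (1 : ℂ)).tendsto_slope
  rw [one_pow, mul_one] at h
  refine h.congr fun q => ?_
  rw [slope_def_field, one_pow, ← neg_sub, ← neg_sub 1 q, neg_div_neg_eq]

theorem tendsto_pow_sub_one_add_div_sq (m : ℕ) :
    Tendsto (fun q : ℂ => (q ^ m - 1 + m * (1 - q)) / (1 - q) ^ 2) (𝓝[≠] 1)
      (𝓝 ((m : ℂ) * (m - 1) / 2)) := by
  induction m with
  | zero => simp
  | succ m ih =>
    have hm : ((m + 1 : ℕ) * ((m + 1 : ℕ) - 1) / 2 : ℂ) = m * (m - 1) / 2 + m := by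
      push_cast
      ring
    rw [hm]
    refine (ih.add (tendsto_one_sub_pow_div m)).congr' ?_
    filter_upwards [self_mem_nhdsWithin] with q hq
    have : 1 - q ≠ 0 := sub_ne_zero.2 (Ne.symm hq)
    push_cast
    field_simp
    ring

/-- The coefficients `c` and the exponents `m` of the polynomial satisfy `∑ c = ∑ c * m = 0`, so
that only the second-order terms of the powers of `q` contribute. -/
theorem tendsto_qGuilleraPoly_div_sq (n : ℕ) :
    Tendsto (fun q : ℂ => (3 * q ^ (2 * n + 1) - 4 * q ^ (4 * n + 1) + 2 * q ^ (4 * n + 2)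
      - 4 * q ^ (6 * n + 1) - 4 * q ^ (6 * n + 2) + 2 * q ^ (8 * n + 1) - 4 * q ^ (8 * n + 2)
      + 3 * q ^ (10 * n + 2) + 3 * q ^ (12 * n + 3) + 3) / (1 - q) ^ 2) (𝓝[≠] 1)
      (𝓝 (2 * (74 * (n : ℂ) ^ 2 + 27 * n + 3))) := by
  have hterm (c : ℂ) (m : ℕ) := (tendsto_pow_sub_one_add_div_sq m).const_mul c
  have h := (((((((hterm 3 (2 * n + 1)).add (hterm (-4) (4 * n + 1))).add
    (hterm 2 (4 * n + 2))).add (hterm (-4) (6 * n + 1))).add (hterm (-4) (6 * n + 2))).add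
    (hterm 2 (8 * n + 1))).add (hterm (-4) (8 * n + 2))).add
    ((hterm 3 (10 * n + 2)).add (hterm 3 (12 * n + 3)))
  convert h using 2 <;>
  · push_cast
    ring

theorem tendsto_qPoch_div_pow (c m : ℕ) {d : ℕ} (hd : d ≠ 0) :
    Tendsto (fun q : ℂ => qPoch (q ^ c) (q ^ d) m / (1 - q) ^ m) (𝓝[≠] 1)
      (𝓝 ((d : ℂ) ^ m * rising (c / d) m)) := by
  have hlim : (d : ℂ) ^ m * rising (c / d) m = ∏ i ∈ Finset.range m, ((c + d * i : ℕ) : ℂ) := by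
    nth_rw 1 [rising, ← Finset.card_range m]
    rw [Finset.pow_card_mul_prod]
    refine Finset.prod_congr rfl fun i _ => ?_
    push_cast
    field_simp
  rw [hlim]
  refine (tendsto_finsetProd _ fun i _ => tendsto_one_sub_pow_div (c + d * i)).congr fun q => ?_
  simp only [qPoch, Finset.prod_div_distrib, Finset.prod_const, Finset.card_range, pow_add, pow_mul]

theorem rising_succ (x : ℂ) (n : ℕ) : rising x (n + 1) = rising x n * (x + n) :=
  Finset.prod_range_succ _ n

theorem rising_one_ne_zero (n : ℕ) : rising 1 n ≠ 0 :=
  Finset.prod_ne_zero_iff.2 fun i _ => by exact_mod_cast (by positivity : 1 + i ≠ 0)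

theorem rising_two_mul (x : ℂ) (n : ℕ) :
    rising x (2 * n) = 4 ^ n * rising (x / 2) n * rising ((x + 1) / 2) n := by
  induction n with
  | zero => simp [rising]
  | succ n ih =>
    rw [show 2 * (n + 1) = 2 * n + 1 + 1 by ring, rising_succ, rising_succ, ih, rising_succ,
      rising_succ]
    push_cast
    ring

theorem rising_three_mul (x : ℂ) (n : ℕ) :
    rising x (3 * n) =
      27 ^ n * rising (x / 3) n * rising ((x + 1) / 3) n * rising ((x + 2) / 3) n := by
  induction n with
  | zero => simp [rising]
  | succ n ih =>
    rw [show 3 * (n + 1) = 3 * n + 1 + 1 + 1 by ring, rising_succ, rising_succ, rising_succ, ih,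
      rising_succ, rising_succ, rising_succ]
    push_cast
    ring

theorem rising_quotient_eq_guilleraTerm (n : ℕ) :
    1 * (2 * (74 * (n : ℂ) ^ 2 + 27 * n + 3)) * (2 ^ (3 * n) * rising 1 (3 * n)) *
      (2 ^ n * rising (1 / 2) n) ^ 6 / ((1 + 1 + 1) * (1 + 1) ^ 3 * (2 ^ n * rising 1 n) ^ 3 *
        (2 ^ (2 * n) * rising 1 (2 * n)) ^ 3) = 1 / 12 * guilleraTerm n := by
  have h4 : (4 : ℂ) ^ n = (2 ^ n) ^ 2 := by
    rw [← pow_mul, pow_mul']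
    norm_num
  rw [guilleraTerm, rising_two_mul, rising_three_mul, div_pow, ← pow_mul, ← pow_mul,
    pow_mul' 4, h4, pow_mul 3 3 n, pow_mul' 2 3, pow_mul' 2 2, show (3 : ℂ) ^ 3 = 27 by norm_num,
    show ((1 + 1) / 2 : ℂ) = 1 by norm_num, show ((1 + 1) / 3 : ℂ) = 2 / 3 by norm_num,
    show ((1 + 2) / 3 : ℂ) = 1 by norm_num]
  field_simp
  ring

theorem tendsto_qGuilleraTerm_div_sq (n : ℕ) :
    Tendsto (fun q : ℂ => qGuilleraTerm q n / (1 - q) ^ 2) (𝓝[≠] 1)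
      (𝓝 (1 / 12 * guilleraTerm n)) := by
  have hpow (m : ℕ) : Tendsto (fun q : ℂ => q ^ m) (𝓝[≠] 1) (𝓝 1) :=
    (Continuous.tendsto' (by fun_prop) 1 1 (by simp)).mono_left nhdsWithin_le_nhds
  have heven (m : ℕ) := tendsto_qPoch_div_pow 2 m two_ne_zero
  have hodd := tendsto_qPoch_div_pow 1 n two_ne_zero
  simp only [pow_one, Nat.cast_one, Nat.cast_ofNat, div_self (two_ne_zero' ℂ)] at heven hodd
  have hne (m : ℕ) : (2 : ℂ) ^ m * rising 1 m ≠ 0 :=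
    mul_ne_zero (pow_ne_zero m two_ne_zero) (rising_one_ne_zero m)
  have hnum := (((hpow (2 * n)).mul (tendsto_qGuilleraPoly_div_sq n)).mul
    (heven (3 * n))).mul (hodd.pow 6)
  have hden := (((((hpow (2 * n)).add (hpow (4 * n))).add_const 1).mul
    (((hpow (2 * n + 1)).add_const 1).pow 3)).mul ((heven n).pow 3)).mul ((heven (2 * n)).pow 3)
  have h := hnum.div hden (mul_ne_zero (mul_ne_zero (by norm_num) (pow_ne_zero _ (hne _)))
    (pow_ne_zero _ (hne _)))
  rw [rising_quotient_eq_guilleraTerm] at h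
  refine h.congr' ?_
  filter_upwards [self_mem_nhdsWithin] with q hq
  have hD : 1 - q ≠ 0 := sub_ne_zero.2 (Ne.symm hq)
  rw [qGuilleraTerm]
  simp only [Pi.div_apply]
  generalize 3 * q ^ (2 * n + 1) - 4 * q ^ (4 * n + 1) + 2 * q ^ (4 * n + 2)
      - 4 * q ^ (6 * n + 1) - 4 * q ^ (6 * n + 2) + 2 * q ^ (8 * n + 1) - 4 * q ^ (8 * n + 2)
      + 3 * q ^ (10 * n + 2) + 3 * q ^ (12 * n + 3) + 3 = P
  generalize q ^ (2 * n) + q ^ (4 * n) + 1 = A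
  generalize q ^ (2 * n + 1) + 1 = B
  generalize 1 - q = D at *
  rw [pow_mul' D 3, pow_mul' D 2]
  have := pow_ne_zero n hD
  generalize D ^ n = d at *
  field_simp

/-! ### The limit of the alternating series -/

/-- The `q`-integer `[m] = 1 + p + ⋯ + p ^ (m - 1)` in base `p`. -/
def qInt (p : ℝ) (m : ℕ) : ℝ := ∑ j ∈ Finset.range m, p ^ j

theorem one_sub_mul_qInt (p : ℝ) (m : ℕ) : (1 - p) * qInt p m = 1 - p ^ m :=
  mul_neg_geom_sum p m

theorem qInt_add_one_pos {p : ℝ} (h0 : 0 < p) (m : ℕ) : 0 < qInt p (m + 1) :=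
  Finset.sum_pos (fun _ _ => pow_pos h0 _) Finset.nonempty_range_add_one

theorem qInt_mono {p : ℝ} (h0 : 0 ≤ p) : Monotone (qInt p) := fun _ _ h =>
  Finset.sum_le_sum_of_subset_of_nonneg (Finset.range_mono h) fun _ _ _ => pow_nonneg h0 _

theorem tendsto_qInt (m : ℕ) : Tendsto (fun p => qInt p m) (𝓝[<] 1) (𝓝 m) :=
  (Continuous.tendsto' (by unfold qInt; fun_prop) 1 _ (by simp [qInt])).mono_left
    nhdsWithin_le_nhds

/-- Pairing the powers of `p` symmetrically about `p ^ i`, this is the inequality between the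
arithmetic and the geometric mean. -/
theorem mul_pow_le_qInt {p : ℝ} (h0 : 0 < p) (i : ℕ) :
    (2 * i + 1) * p ^ i ≤ qInt p (2 * i + 1) := by
  induction i with
  | zero => simp [qInt]
  | succ i ih =>
    have hstep : qInt p (2 * (i + 1) + 1) = 1 + p * qInt p (2 * i + 1) + p ^ (2 * i + 2) := by
      rw [qInt, mul_add_one, Finset.sum_range_succ, Finset.sum_range_succ', qInt, Finset.mul_sum]
      simp only [pow_succ', pow_zero]
      ring
    have hmean : 2 * p ^ (i + 1) ≤ 1 + p ^ (2 * i + 2) := by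
      linear_combination sq_nonneg (1 - p ^ (i + 1))
    rw [hstep]
    push_cast
    linear_combination p * ih + hmean

/-- The absolute value of `altTerm p k`. -/
noncomputable def altAbs (p : ℝ) (k : ℕ) : ℝ :=
  p ^ (3 * k * (k + 1)) * ((1 + p ^ (2 * k + 1)) / (1 + p)) / qInt p (2 * k + 1)

theorem altTerm_ofReal {p : ℝ} (h1 : p < 1) (k : ℕ) :
    altTerm p k = ((-1) ^ k * altAbs p k : ℝ) := by
  have hp : 1 - p ≠ 0 := (sub_pos.2 h1).ne'
  have hodd : (1 - p) / (1 - p ^ (2 * k + 1)) = (qInt p (2 * k + 1))⁻¹ := by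
    rw [← one_sub_mul_qInt, div_mul_cancel_left₀ hp]
  rw [altAbs, div_eq_mul_inv _ (qInt _ _), ← hodd, altTerm]
  push_cast
  ring

theorem tsum_altTerm_ofReal {p : ℝ} (h1 : p < 1) :
    ∑' k, altTerm p k = (∑' k, (-1) ^ k * altAbs p k : ℝ) := by
  rw [Complex.ofReal_tsum]
  exact tsum_congr (altTerm_ofReal h1)

theorem altAbs_nonneg {p : ℝ} (h0 : 0 < p) (k : ℕ) : 0 ≤ altAbs p k := by
  have := qInt_add_one_pos h0 (2 * k)
  unfold altAbs
  positivity

section AltAbs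

variable {p : ℝ} (h0 : 0 < p) (h1 : p < 1)
include h0 h1

theorem antitone_altAbs : Antitone (altAbs p) := by
  refine antitone_nat_of_succ_le fun k => ?_
  have hpos := qInt_add_one_pos h0 (2 * k)
  have hqInt : qInt p (2 * k + 1) ≤ qInt p (2 * (k + 1) + 1) := qInt_mono h0.le (by lia)
  have hpow : p ^ (3 * (k + 1) * (k + 1 + 1)) ≤ p ^ (3 * k * (k + 1)) :=
    pow_le_pow_of_le_one h0.le h1.le (by gcongr <;> lia)
  have hodd : p ^ (2 * (k + 1) + 1) ≤ p ^ (2 * k + 1) :=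
    pow_le_pow_of_le_one h0.le h1.le (by lia)
  unfold altAbs
  gcongr

theorem altAbs_le (k : ℕ) : altAbs p k ≤ 1 / (2 * k + 1) := by
  have hpow : p ^ (3 * k * (k + 1)) ≤ p ^ k := pow_le_pow_of_le_one h0.le h1.le (by nlinarith)
  have hfrac : (1 + p ^ (2 * k + 1)) / (1 + p) ≤ 1 := by
    rw [div_le_one (by positivity), add_le_add_iff_left]
    exact pow_le_of_le_one h0.le h1.le (by lia)
  rw [altAbs, div_le_div_iff₀ (qInt_add_one_pos h0 _) (by positivity), one_mul]
  calc p ^ (3 * k * (k + 1)) * ((1 + p ^ (2 * k + 1)) / (1 + p)) * (2 * k + 1)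
      ≤ p ^ k * 1 * (2 * k + 1) := by gcongr
    _ = (2 * k + 1) * p ^ k := by ring
    _ ≤ qInt p (2 * k + 1) := mul_pow_le_qInt h0 k

theorem summable_altAbs : Summable (altAbs p) := by
  refine (summable_altTerm (norm_ofReal_lt_one h0 h1)).norm.congr fun k => ?_
  rw [altTerm_ofReal h1, Complex.norm_real, norm_mul, norm_pow, norm_neg, norm_one, one_pow,
    one_mul, Real.norm_of_nonneg (altAbs_nonneg h0 k)]

theorem tsum_altTerm_ne_zero : ∑' k, altTerm p k ≠ 0 := by
  rw [tsum_altTerm_ofReal h1, Complex.ofReal_ne_zero]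
  have herror := alternating_series_error_bound _ (antitone_altAbs h0 h1)
    (summable_altAbs h0 h1) 1
  have hzero : altAbs p 0 = 1 := by
    have : 1 + p ≠ 0 := by positivity
    simp [altAbs, qInt, this]
  have hone := altAbs_le h0 h1 1
  intro hsum
  norm_num [hsum, hzero] at herror hone
  linarith

end AltAbs

theorem tendsto_tsum_alternating {ι : Type*} {l : Filter ι} {f : ι → ℕ → ℝ} {g b : ℕ → ℝ} {L : ℝ}
    (hanti : ∀ᶠ p in l, Antitone (f p)) (hsum : ∀ᶠ p in l, Summable (f p))
    (hle : ∀ᶠ p in l, ∀ k, f p k ≤ b k) (hb : Tendsto b atTop (𝓝 0))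
    (hlim : ∀ k, Tendsto (f · k) l (𝓝 (g k)))
    (hL : Tendsto (fun N => ∑ k ∈ Finset.range N, (-1) ^ k * g k) atTop (𝓝 L)) :
    Tendsto (fun p => ∑' k, (-1) ^ k * f p k) l (𝓝 L) := by
  have hunif : TendstoUniformlyOnFilter
      (fun N p => ∑ k ∈ Finset.range N, (-1) ^ k * f p k)
      (fun p => ∑' k, (-1) ^ k * f p k) atTop l := by
    rw [Metric.tendstoUniformlyOnFilter_iff]
    intro ε hε
    filter_upwards [(hb.eventually_lt_const hε).prod_mk (hanti.and (hsum.and hle))]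
      with ⟨N, p⟩ ⟨hN, hanti, hsum, hle⟩
    exact (alternating_series_error_bound _ hanti hsum N).trans_lt ((hle N).trans_lt hN)
  exact hunif.tendsto_of_eventually_tendsto
    (.of_forall fun N => tendsto_finsetSum _ fun k _ => (hlim k).const_mul _) hL

theorem eventually_mem_Ioo_zero_one : ∀ᶠ p : ℝ in 𝓝[<] 1, 0 < p ∧ p < 1 :=
  Ioo_mem_nhdsLT one_pos

theorem tendsto_pow_one_left (m : ℕ) : Tendsto (fun p : ℝ => p ^ m) (𝓝[<] 1) (𝓝 1) :=
  (Continuous.tendsto' (by fun_prop) 1 1 (by simp)).mono_left nhdsWithin_le_nhds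

theorem tendsto_altAbs (k : ℕ) : Tendsto (fun p => altAbs p k) (𝓝[<] 1) (𝓝 (1 / (2 * k + 1))) := by
  have hone : Tendsto (fun p : ℝ => 1 + p) (𝓝[<] 1) (𝓝 (1 + 1)) := by
    simpa using (tendsto_pow_one_left 1).const_add 1
  have h := ((tendsto_pow_one_left (3 * k * (k + 1))).mul
    (((tendsto_pow_one_left (2 * k + 1)).const_add 1).div hone (by norm_num))).div
    (tendsto_qInt (2 * k + 1)) (by positivity)
  rw [div_self (by norm_num), one_mul] at h
  exact_mod_cast h

theorem tendsto_tsum_altAbs :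
    Tendsto (fun p => ∑' k, (-1) ^ k * altAbs p k) (𝓝[<] 1) (𝓝 (Real.pi / 4)) := by
  refine tendsto_tsum_alternating (g := fun k => 1 / (2 * k + 1)) (b := fun k => 1 / (2 * k + 1))
    (eventually_mem_Ioo_zero_one.mono fun p hp => antitone_altAbs hp.1 hp.2)
    (eventually_mem_Ioo_zero_one.mono fun p hp => summable_altAbs hp.1 hp.2)
    (eventually_mem_Ioo_zero_one.mono fun p hp => altAbs_le hp.1 hp.2) ?_ tendsto_altAbs ?_
  · have hdouble : Tendsto (fun k : ℕ => 2 * k) atTop atTop :=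
      tendsto_id.const_mul_atTop' two_pos
    simpa [Function.comp_def] using
      (tendsto_one_div_add_atTop_nhds_zero_nat (𝕜 := ℝ)).comp hdouble
  · simpa only [mul_one_div] using Real.tendsto_sum_pi_div_four

/-! ### The `q`-Wallis product -/

/-- The factors of the `q`-Wallis product for `Γ_{q ^ 2}(1 / 2) ^ 2` are `1 + wallisTerm q i`, see
`qGamma_half_sq`. -/
noncomputable def wallisTerm (q : ℝ) (i : ℕ) : ℝ :=
  q ^ (2 * i + 1) / (qInt q (2 * i + 1) * qInt q (2 * (i + 1) + 1))

theorem wallisTerm_nonneg {q : ℝ} (h0 : 0 < q) (i : ℕ) : 0 ≤ wallisTerm q i :=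
  div_nonneg (pow_nonneg h0.le _)
    (mul_nonneg (qInt_add_one_pos h0 _).le (qInt_add_one_pos h0 _).le)

theorem wallisTerm_le {q : ℝ} (h0 : 0 < q) (i : ℕ) :
    wallisTerm q i ≤ 1 / ((2 * i + 1) * (2 * (i + 1 : ℕ) + 1)) := by
  rw [wallisTerm, div_le_div_iff₀ (mul_pos (qInt_add_one_pos h0 _) (qInt_add_one_pos h0 _))
    (by positivity), one_mul]
  calc q ^ (2 * i + 1) * ((2 * i + 1) * (2 * (i + 1 : ℕ) + 1))
      = (2 * i + 1) * q ^ i * ((2 * (i + 1 : ℕ) + 1) * q ^ (i + 1)) := by ring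
    _ ≤ qInt q (2 * i + 1) * qInt q (2 * (i + 1) + 1) :=
      mul_le_mul (mul_pow_le_qInt h0 i) (mul_pow_le_qInt h0 (i + 1)) (by positivity)
        (qInt_add_one_pos h0 _).le

theorem summable_one_div_odd_mul_odd :
    Summable fun i : ℕ => 1 / ((2 * (i : ℝ) + 1) * (2 * (i + 1 : ℕ) + 1)) := by
  refine ((summable_nat_add_iff 1).2 (Real.summable_one_div_nat_pow.2 one_lt_two)).of_nonneg_of_le
    (fun i => by positivity) fun i => one_div_le_one_div_of_le (by positivity) ?_
  push_cast
  nlinarith [(Nat.cast_nonneg i : (0 : ℝ) ≤ i)]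

theorem norm_wallisTerm_le {q : ℝ} (h0 : 0 < q) (i : ℕ) :
    ‖wallisTerm q i‖ ≤ 1 / ((2 * i + 1) * (2 * (i + 1 : ℕ) + 1)) := by
  rw [Real.norm_of_nonneg (wallisTerm_nonneg h0 i)]
  exact wallisTerm_le h0 i

theorem one_add_wallisTerm_mul {q : ℝ} (h0 : 0 < q) (i : ℕ) :
    (1 + wallisTerm q i) * ((1 - q * (q ^ 2) ^ i) * (1 - q ^ 3 * (q ^ 2) ^ i)) =
      (1 - q ^ 2 * (q ^ 2) ^ i) ^ 2 := by
  have hleft := one_sub_mul_qInt q (2 * i + 1)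
  have hright := one_sub_mul_qInt q (2 * (i + 1) + 1)
  have hl := (qInt_add_one_pos h0 (2 * i)).ne'
  have hr := (qInt_add_one_pos h0 (2 * (i + 1))).ne'
  have hexpand : (1 + wallisTerm q i) * (((1 - q) * qInt q (2 * i + 1)) *
      ((1 - q) * qInt q (2 * (i + 1) + 1))) = ((1 - q) * qInt q (2 * i + 1)) *
        ((1 - q) * qInt q (2 * (i + 1) + 1)) + (1 - q) ^ 2 * q ^ (2 * i + 1) := by
    rw [wallisTerm]
    field_simp
  rw [hleft, hright] at hexpand
  linear_combination hexpand

theorem tprod_one_add_wallisTerm_mul {q : ℝ} (h0 : 0 < q) (h1 : q < 1) :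
    ((∏' i, (1 + wallisTerm q i) : ℝ) : ℂ) *
        (qPochInf q ((q : ℂ) ^ 2) * qPochInf ((q : ℂ) ^ 3) ((q : ℂ) ^ 2)) =
      qPochInf ((q : ℂ) ^ 2) ((q : ℂ) ^ 2) ^ 2 := by
  have hq := norm_sq_lt_one (norm_ofReal_lt_one h0 h1)
  have hpoch (a : ℂ) := multipliable_one_sub_mul_pow a hq
  have hwallis : Multipliable fun i => 1 + wallisTerm q i :=
    multipliable_one_add_of_summable
      (summable_one_div_odd_mul_odd.of_nonneg_of_le (fun _ => norm_nonneg _)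
        (norm_wallisTerm_le h0))
  have hcast : ((∏' i, (1 + wallisTerm q i) : ℝ) : ℂ) = ∏' i, ((1 + wallisTerm q i : ℝ) : ℂ) :=
    hwallis.map_tprod Complex.ofRealHom Complex.continuous_ofReal
  have hwallis' : Multipliable fun i => ((1 + wallisTerm q i : ℝ) : ℂ) :=
    hwallis.map Complex.ofRealHom Complex.continuous_ofReal
  rw [hcast, qPochInf, qPochInf, qPochInf, ← (hpoch _).tprod_mul (hpoch _),
    ← hwallis'.tprod_mul ((hpoch _).mul (hpoch _)), ← (hpoch _).tprod_pow]
  exact tprod_congr fun i => mod_cast one_add_wallisTerm_mul h0 i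

theorem qGamma_half_sq {q : ℝ} (h0 : 0 < q) (h1 : q < 1) :
    qGamma (q ^ 2) (1 / 2) ^ 2 = (1 + (q : ℂ)) * ((∏' i, (1 + wallisTerm q i) : ℝ) : ℂ) := by
  have hq := norm_ofReal_lt_one h0 h1
  have hq2 := norm_sq_lt_one hq
  have hD := one_sub_ofReal_ne_zero h1
  have hprod := tprod_one_add_wallisTerm_mul h0 h1
  have hshift := qPochInf_eq_mul (q : ℂ) hq2 1
  rw [qPoch_succ, qPoch_zero, pow_zero, one_mul, mul_one, pow_one, ← pow_succ'] at hshift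
  have hne := qPochInf_ne_zero hq2 (one_sub_mul_pow_ne_zero hq hq2)
  rw [hshift] at hne hprod
  have hroot : ((1 - (q : ℂ) ^ 2) ^ (1 - 1 / 2 : ℂ)) ^ 2 = (1 - q) * (1 + q) := by
    rw [sub_half, cpow_half_sq]
    ring
  rw [qGamma, sq_cpow_half h0, Complex.ofReal_pow, hshift, div_pow, mul_pow, hroot, ← hprod]
  generalize 1 - (q : ℂ) = D at *
  have := right_ne_zero_of_mul hne
  field_simp

theorem tendsto_wallisTerm (i : ℕ) : Tendsto (fun q => wallisTerm q i) (𝓝[<] 1)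
    (𝓝 (1 / ((2 * i + 1) * (2 * (i + 1 : ℕ) + 1)))) := by
  exact_mod_cast (tendsto_pow_one_left (2 * i + 1)).div
    ((tendsto_qInt (2 * i + 1)).mul (tendsto_qInt (2 * (i + 1) + 1))) (by positivity)

theorem tprod_one_add_one_div_odd_mul_odd :
    ∏' i : ℕ, (1 + 1 / ((2 * (i : ℝ) + 1) * (2 * (i + 1 : ℕ) + 1))) = Real.pi / 2 := by
  refine tendsto_nhds_unique (multipliable_one_add_of_summable
    summable_one_div_odd_mul_odd.norm).hasProd.tendsto_prod_nat
    (Real.tendsto_prod_pi_div_two.congr fun n => Finset.prod_congr rfl fun i _ => ?_)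
  push_cast
  field_simp
  ring

theorem tendsto_ofReal_nhdsLT_one : Tendsto (fun q : ℝ => (q : ℂ)) (𝓝[<] 1) (𝓝[≠] 1) := by
  refine tendsto_nhdsWithin_iff.2 ⟨(Continuous.tendsto' (by fun_prop) 1 1 (by simp)).mono_left
    nhdsWithin_le_nhds, ?_⟩
  filter_upwards [self_mem_nhdsWithin] with q hq
  exact Complex.ofReal_ne_one.2 (ne_of_lt hq)

theorem tendsto_one_add_ofReal : Tendsto (fun q : ℝ => 1 + (q : ℂ)) (𝓝[<] 1) (𝓝 2) := by
  rw [← one_add_one_eq_two]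
  exact (tendsto_nhds_of_tendsto_nhdsWithin tendsto_ofReal_nhdsLT_one).const_add 1

theorem tendsto_qGamma_half_sq :
    Tendsto (fun q : ℝ => qGamma (q ^ 2) (1 / 2) ^ 2) (𝓝[<] 1) (𝓝 (Real.pi : ℂ)) := by
  have hprod := tendsto_tprod_one_add_of_dominated_convergence summable_one_div_odd_mul_odd
    tendsto_wallisTerm (eventually_mem_Ioo_zero_one.mono fun q hq => norm_wallisTerm_le hq.1)
  rw [tprod_one_add_one_div_odd_mul_odd] at hprod
  have hlim := tendsto_one_add_ofReal.mul ((Complex.continuous_ofReal.tendsto _).comp hprod)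
  have hvalue : 2 * ((Real.pi / 2 : ℝ) : ℂ) = Real.pi := by
    push_cast
    ring
  rw [hvalue] at hlim
  refine hlim.congr' ?_
  filter_upwards [eventually_mem_Ioo_zero_one] with q hq
  exact (qGamma_half_sq hq.1 hq.2).symm

theorem tendsto_qGuilleraValue :
    Tendsto (fun q : ℝ => qGuilleraValue q / (1 - (q : ℂ)) ^ 2) (𝓝[<] 1)
      (𝓝 (1 / 12 * (48 / (Real.pi : ℂ) ^ 2))) := by
  have hpi : (Real.pi : ℂ) ≠ 0 := by exact_mod_cast Real.pi_ne_zero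
  have hlim := ((tendsto_one_add_ofReal.pow 4).div (tendsto_qGamma_half_sq.pow 3)
    (pow_ne_zero 3 hpi)).mul ((Complex.continuous_ofReal.tendsto _).comp tendsto_tsum_altAbs)
  have hvalue : 2 ^ 4 / (Real.pi : ℂ) ^ 3 * ((Real.pi / 4 : ℝ) : ℂ) =
      1 / 12 * (48 / (Real.pi : ℂ) ^ 2) := by
    push_cast
    field_simp
    norm_num
  rw [hvalue] at hlim
  refine hlim.congr' ?_
  filter_upwards [eventually_mem_Ioo_zero_one] with q hq
  have hD := one_sub_ofReal_ne_zero hq.2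
  simp only [Function.comp, Pi.div_apply]
  rw [qGuilleraValue, ← tsum_altTerm_ofReal hq.2,
    show qGamma (q ^ 2) (1 / 2) ^ 6 = (qGamma (q ^ 2) (1 / 2) ^ 2) ^ 3 by ring,
    show 1 - (q : ℂ) ^ 2 = (1 - q) * (1 + q) by ring]
  generalize qGamma (q ^ 2) (1 / 2) ^ 2 = G
  generalize 1 - (q : ℂ) = D at *
  field_simp

/-! ### The identity with the parameter `a` -/

namespace GenericParam

variable {q : ℝ} {a : ℂ}

theorem summable_wzF (h : GenericParam q a) : Summable (wzF q a) :=
  (h.wzParam.summable_wzKernel.mul_left _).congr fun k => (h.wzF_eq k).symm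

theorem summable_kTerm (h : GenericParam q a) : Summable (kTerm q a) :=
  (h.wzParam.summable_wzKernel.div_const _).congr fun k => (h.kTerm_eq k).symm

theorem tendsto_tsum_wzF (h : GenericParam q a) :
    Tendsto (fun n : ℕ => ∑' k, wzF q (n + a) k) atTop (𝓝 (boundaryValue q a)) := by
  rw [← h.wzScale_mul_wzConst_mul_tsum]
  simpa only [cpow_half_sq, h.wzF_natCast_add, tsum_mul_left]
    using h.wzParam.tendsto_wzWeight_mul_tsum.const_mul (wzScale q a)

theorem hasSum_nTerm (h : GenericParam q a) :
    HasSum (nTerm q a) (∑' k, kTerm q a k - 1 / factorA q a * boundaryValue q a) := by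
  have hA := h.factorA_ne_zero
  have hvalue : ∑' k, kTerm q a k - 1 / factorA q a * boundaryValue q a =
      (∑' k, wzKernel ((q : ℂ) ^ (1 / 2 : ℂ)) ((q : ℂ) ^ a) k -
        wzConst ((q : ℂ) ^ (1 / 2 : ℂ)) ((q : ℂ) ^ a) *
          ∑' k, ((q : ℂ) ^ (1 / 2 : ℂ)) ^ k /
            qPoch ((q : ℂ) ^ (1 / 2 : ℂ)) (((q : ℂ) ^ (1 / 2 : ℂ)) ^ 2) (k + 1)) /
        (1 - (q : ℂ) ^ a) ^ 3 := by
    rw [← h.wzScale_mul_wzConst_mul_tsum, wzScale, tsum_congr h.kTerm_eq, tsum_div_const]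
    field_simp
  rw [hvalue]
  refine (h.wzParam.hasSum_wzWeight_mul_wzMateZero.div_const _).congr_fun fun n => ?_
  rw [h.nTerm_eq, cpow_half_sq]

theorem boundaryValue_ne_zero (h : GenericParam q a) : boundaryValue q a ≠ 0 := by
  have hx := h.cpow_ne_zero a
  have g1 := h.qGamma_ne_zero (-2) (-2) (z := 1 - a) (.inl (by push_cast; ring))
  have g2 := h.qGamma_ne_zero 2 0 (z := a) (.inl (by push_cast; ring))
  have g3 := qGamma_ne_zero_of_re_pos h.pos h.lt_one (z := 3 / 2) (by norm_num)
  have g4 := h.qGamma_ne_zero (-2) (-1) (z := 1 / 2 - a) (.inl (by push_cast; ring))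
  have g5 := h.qGamma_ne_zero 2 1 (z := a + 1 / 2) (.inl (by push_cast; ring))
  have hcast : (q : ℂ) ^ (1 / 2 : ℂ) = ((q ^ (1 / 2 : ℝ) : ℝ) : ℂ) := by
    rw [Complex.ofReal_cpow h.pos.le]
    norm_num
  have hseries : ∑' k, altTerm ((q : ℂ) ^ (1 / 2 : ℂ)) k ≠ 0 := by
    rw [hcast]
    exact tsum_altTerm_ne_zero (Real.rpow_pos_of_pos h.pos _)
      (Real.rpow_lt_one h.pos.le h.lt_one (by norm_num))
  unfold boundaryValue
  positivity

end GenericParam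

theorem mainTheorem5 :
    -- the `q`-series identity
    (∀ q : ℝ, 0 < q → q < 1 →
      Summable (fun k : ℕ => altTerm q k) ∧
      HasSum (fun n : ℕ => qGuilleraTerm q n) (qGuilleraValue q)) ∧
    -- it is a `q`-analogue of Guillera's formula
    (∀ n : ℕ, Tendsto (fun q : ℝ => qGuilleraTerm q n / (1 - (q : ℂ)) ^ 2) (𝓝[<] 1)
      (𝓝 (1 / 12 * guilleraTerm n))) ∧
    Tendsto (fun q : ℝ => qGuilleraValue q / (1 - (q : ℂ)) ^ 2) (𝓝[<] 1)
      (𝓝 (1 / 12 * (48 / (Real.pi : ℂ) ^ 2))) ∧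
    -- the boundary limit and the identity with the parameter `a`
    (∀ (q : ℝ) (a : ℂ), 0 < q → q < 1 →
      (∀ m : ℤ, (q : ℂ) ^ (2 * a) ≠ (q : ℂ) ^ m ∧ (q : ℂ) ^ (3 * a) ≠ (q : ℂ) ^ m) →
      (∀ n : ℕ, Summable (fun k : ℕ => wzF q (n + a) k)) ∧
      Summable (fun k : ℕ => altTerm ((q : ℂ) ^ (1 / 2 : ℂ)) k) ∧
      Tendsto (fun n : ℕ => ∑' k : ℕ, wzF q (n + a) k) atTop (𝓝 (boundaryValue q a)) ∧
      boundaryValue q a ≠ 0 ∧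
      factorA q a ≠ 0 ∧
      Summable (fun k : ℕ => kTerm q a k) ∧
      Summable (fun n : ℕ => nTerm q a n) ∧
      (∑' k : ℕ, kTerm q a k) =
        (∑' n : ℕ, nTerm q a n) + 1 / factorA q a * boundaryValue q a) := by
  refine ⟨fun q h0 h1 => ⟨summable_altTerm (norm_ofReal_lt_one h0 h1), hasSum_qGuilleraTerm h0 h1⟩,
    fun n => (tendsto_qGuilleraTerm_div_sq n).comp tendsto_ofReal_nhdsLT_one,
    tendsto_qGuilleraValue, fun q a h0 h1 hne => ?_⟩
  have h : GenericParam q a := ⟨h0, h1, hne⟩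
  refine ⟨fun n => (h.add_nat n).summable_wzF, summable_altTerm (norm_cpow_half_lt_one h0 h1),
    h.tendsto_tsum_wzF, h.boundaryValue_ne_zero, h.factorA_ne_zero, h.summable_kTerm,
    h.hasSum_nTerm.summable, ?_⟩
  rw [h.hasSum_nTerm.tsum_eq, sub_add_cancel]
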